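/- **Fully-discrete energy stability.** Let $d\ge 1$, let $\Omega\subset\mathbb R^d$ be an open set with $\Omega=\operatorname{int}\overline\Omega$, and let $\mathcal T$ be a conforming triangulation of $\overline\Omega$ by finitely many open $d$-simplices (two closed simplices meet in a common, possibly empty, sub-simplex). Let $\mathcal E$ be the set of interfaces (facets shared by two simplices) and let boundary facets be those contained in $\partial\Omega$. For $k\in\mathbb N$ let $V_h$ be the space of functions that are polynomials of degree $\le k$ on each $T\in\mathcal T$; let $V_{h,0}\subset V_h$ be the functions with zero trace on $\partial\Omega$, $V_{h,\mathbf n}\subset (V_h)^d$ the fields with zero normal trace on $\partial\Omega$, and $\mathcal V_h=V_h\times (V_{h,0})^d\times V_h\times V_h\times V_h\times V_{h,\mathbf n}$. All derivatives are taken elementwise. On an interface of $T_1,T_2$, with outward unit normals $\mathbf n_{T_i}$, put $\{g\}=\frac12(g|_{T_1}+g|_{T_2})$, $[\Phi]=\sum_i\Phi|_{T_i}\mathbf n_{T_i}$, $[\mathbf u]=\sum_i\mathbf u|_{T_i}\cdot\mathbf n_{T_i}$, $[\mathbf u]_\otimes=\sum_i\mathbf u|_{T_i}\otimes\mathbf n_{T_i}$;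 on a boundary facet only the one adjacent simplex contributes and $\{g\}=g|_T$. Let $\tilde f:\mathbb R^2\to\mathbb R$, $F(\rho,\varphi)=\rho\tilde f(\rho,\varphi)$, let $\gamma,\eta,\alpha_B$ be real constants, and let $\mathbf S(\nabla\mathbf v,\varphi)=\nu_1(\varphi)(\nabla\mathbf v+\nabla\mathbf v^{\top})+\nu_2(\varphi)\operatorname{div}\mathbf v\, I$ with functions $\nu_1,\nu_2:\mathbb R\to\mathbb R$. Define $$B_h[\varphi;\mathbf v,\mathbf X]=\int_\Omega\mathbf S(\nabla\mathbf v,\varphi):\nabla\mathbf X\,dx-\int_{\mathcal E\cup\partial\Omega}\{\mathbf S(\nabla\mathbf v,\varphi)\}:[\mathbf X]_\otimes+\{\mathbf S(\nabla\mathbf X,\varphi)\}:[\mathbf v]_\otimes\,ds+\int_{\mathcal E\cup\partial\Omega}\frac{\alpha_B}{|e|}[\mathbf v]_\otimes:[\mathbf X]_\otimes\,ds .$$ Let $0=t_0<\dots<t_N=t_{\rm end}$, $\Delta t_n=t_{n+1}-t_n$, let $(\rho_0,\mathbf v_0,\varphi_0,\mu_0,\tau_0,\boldsymbol\sigma_0)$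 be initial functions in $L^2(\Omega)$, and write $g^n=g(t_n)$, $g^{n+\frac12}=\frac12(g^n+g^{n+1})$. A *fully discrete dG approximation* is a function $U_h=(\rho_h,\mathbf v_h,\varphi_h,\mu_h,\tau_h,\boldsymbol\sigma_h):[0,t_{\rm end}]\to\mathcal V_h$ that is affine on every $[t_n,t_{n+1}]$, whose initial value $U_h(0)$ is the $L^2$-projection of the initial functions onto $\mathcal V_h$, such that for every $t$ one has $\rho_h>0$ and $\varphi_h\in[0,1]$ a.e., $\rho_h^{-1}$, $F(\rho_h,\varphi_h)$, $\rho_h|\mathbf v_h|^2\in C^0([0,t_{\rm end}];L^2(\Omega))$, and such that for all $0\le n<N$ and all $(\psi,\mathbf X,\Theta,\chi,\zeta,\mathbf Z)\in\mathcal V_h$ (in (1)–(5), $\rho,\mathbf v,\varphi,\mu,\tau,\boldsymbol\sigma$ without superscript denote the values at $n+\frac12$) $$\begin{aligned} (1)\ 0&=\int_\Omega\Big(\tfrac{\rho_h^{n+1}-\rho_h^n}{\Delta t_n}+\operatorname{div}(\rho\mathbf v)\Big)\psi\,dx-\int_{\mathcal E}[\rho\mathbf v]\{\psi\}\,ds,\\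 (2)\ 0&=\int_\Omega\Big(\rho\tfrac{\mathbf v_h^{n+1}-\mathbf v_h^n}{\Delta t_n}+\operatorname{div}(\rho\mathbf v\otimes\mathbf v)-\operatorname{div}(\rho\mathbf v)\mathbf v-\tfrac12\rho\nabla|\mathbf v|^2+\rho\nabla\tau-\mu\nabla\varphi\Big)\cdot\mathbf X\,dx\\ &\quad-\int_{\mathcal E}[\tau]\cdot\{\rho\mathbf X\}-[\varphi]\cdot\{\mu\mathbf X\}\,ds+B_h[\varphi;\mathbf v,\mathbf X],\\ (3)\ 0&=\int_\Omega\Big(\tfrac{\varphi_h^{n+1}-\varphi_h^n}{\Delta t_n}+\nabla\varphi\cdot\mathbf v+\eta\tfrac{\mu}{\rho}\Big)\Theta\,dx-\int_{\mathcal E}[\varphi]\cdot\{\Theta\mathbf v\}\,ds,\\ (4)\ 0&=\int_\Omega\big(\mu-Q_\varphi+\gamma\operatorname{div}\boldsymbol\sigma\big)\chi\,dx-\int_{\mathcal E}\gamma[\boldsymbol\sigma]\{\chi\}\,ds,\\ (5)\ 0&=\int_\Omega\big(\tau-Q_\rho-\tfrac14(|\mathbf v_h^{n+1}|^2+|\mathbf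 v_h^n|^2)\big)\zeta\,dx,\\ (6)\ 0&=\int_\Omega(\boldsymbol\sigma_h^{n+1}-\nabla\varphi_h^{n+1})\cdot\mathbf Z\,dx+\int_{\mathcal E}[\varphi_h^{n+1}]\cdot\{\mathbf Z\}\,ds, \end{aligned}$$ where $$Q_\varphi=\frac{F(\rho^{n+1}_h,\varphi^{n+1}_h)-F(\rho^{n+1}_h,\varphi^{n}_h)+F(\rho^{n}_h,\varphi^{n+1}_h)-F(\rho^{n}_h,\varphi^{n}_h)}{2(\varphi^{n+1}_h-\varphi^n_h)},$$ $$Q_\rho=\frac{F(\rho^{n+1}_h,\varphi^{n+1}_h)-F(\rho^{n}_h,\varphi^{n+1}_h)+F(\rho^{n+1}_h,\varphi^{n}_h)-F(\rho^{n}_h,\varphi^{n}_h)}{2(\rho^{n+1}_h-\rho^n_h)}$$ are assumed integrable on $\Omega$ (where a denominator vanishes, the difference quotients are read as the corresponding derivatives). Then every fully discrete dG approximation satisfies: 1. (mass conservation) $\int_\Omega\rho_h(x,t)\,dx=\int_\Omega\rho_0(x)\,dx$ for all $t\in[0,t_{\rm end}]$; 2. (energy dissipation) with $\hat E_h(t_n)=\int_\Omega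 F(\rho_h^n,\varphi_h^n)+\frac\gamma2|\boldsymbol\sigma_h^n|^2+\frac{\rho_h^n}2|\mathbf v_h^n|^2\,dx$, $$\hat E_h(t_{n+1})\le\hat E_h(t_n)-\Delta t_n\int_\Omega\eta\frac{|\mu_h^{n+\frac12}|^2}{\rho_h^{n+\frac12}}\,dx-\Delta t_n\,B_h\big[\varphi_h^{n+\frac12};\mathbf v_h^{n+\frac12},\mathbf v_h^{n+\frac12}\big]$$ for every $1\le n<N$, and also for $n=0<N$ provided that the discrete initial data satisfy the discrete gradient relation $0=\int_\Omega(\boldsymbol\sigma_h^0-\nabla\varphi_h^0)\cdot\mathbf Z\,dx+\int_{\mathcal E}[\varphi_h^0]\cdot\{\mathbf Z\}\,ds$ for all $\mathbf Z\in V_{h,\mathbf n}$. -/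

import Mathlib

open scoped MeasureTheory Matrix Topology

noncomputable section

namespace NSAC

/-- The Euclidean space of dimension `d`. -/
abbrev E (d : ℕ) : Type := EuclideanSpace ℝ (Fin d)

/-! ### Conforming simplicial meshes -/

/-- A conforming triangulation of (the closure of) `Ω`.  A mesh element is recorded by the set `K`
of its `d + 1` vertices; the element itself is the open simplex `interior (convexHull ℝ K)`.
Two closed elements meet in the closed simplex spanned by their common vertices, which is a common
sub-simplex (possibly empty). -/
structure Triangulation (d : ℕ) (Ω : Set (E d)) where
  cells : Finset (Finset (E d))
  card_cell : ∀ K ∈ cells, K.card = d + 1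
  indep : ∀ K ∈ cells, AffineIndependent ℝ (fun p : K => (p : E d))
  conforming : ∀ K ∈ cells, ∀ L ∈ cells,
    convexHull ℝ (K : Set (E d)) ∩ convexHull ℝ (L : Set (E d)) =
      convexHull ℝ ((K : Set (E d)) ∩ (L : Set (E d)))
  cover : (⋃ K ∈ cells, convexHull ℝ (K : Set (E d))) = closure Ω

variable {d : ℕ} {Ω : Set (E d)}

/-- The type of mesh elements. -/
abbrev Cell (T : Triangulation d Ω) : Type := {K : Finset (E d) // K ∈ T.cells}

/-- The open simplex belonging to a mesh element. -/
def openCell (T : Triangulation d Ω) (K : Cell T) : Set (E d) :=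
  interior (convexHull ℝ (K.1 : Set (E d)))

/-- All facets (`(d-1)`-dimensional faces, given by their `d` vertices) of the mesh elements. -/
def facets (T : Triangulation d Ω) : Finset (Finset (E d)) := by
  classical exact T.cells.biUnion (fun K => K.powersetCard d)

/-- The mesh elements that have `F` as a facet. -/
def adj (T : Triangulation d Ω) (F : Finset (E d)) : Finset (Cell T) := by
  classical exact Finset.univ.filter (fun K : Cell T => F ⊆ K.1)

/-- The interfaces: facets shared by two distinct mesh elements. -/
def interfaces (T : Triangulation d Ω) : Finset (Finset (E d)) := by
  classical exact (facets T).filter (fun F => (adj T F).card = 2)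

/-- The boundary facets: facets that lie in `∂Ω`. -/
def boundaryFacets (T : Triangulation d Ω) : Finset (Finset (E d)) := by
  classical exact (facets T).filter (fun F => convexHull ℝ (F : Set (E d)) ⊆ frontier Ω)

/-- Interfaces together with boundary facets. -/
def allFaces (T : Triangulation d Ω) : Finset (Finset (E d)) := by
  classical exact interfaces T ∪ boundaryFacets T

/-- `ν` is the outward unit normal of the simplex `K` on its facet `F`. -/
def IsOutwardNormal (K F : Finset (E d)) (ν : E d) : Prop :=
  ‖ν‖ = 1 ∧ (∀ p ∈ F, ∀ q ∈ F, inner ℝ ν (q - p) = 0) ∧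
    ∀ r ∈ K, r ∉ F → ∀ p ∈ F, inner ℝ ν (r - p) < 0

/-- The outward unit normal of the simplex `K` on its facet `F` (it exists and is unique for a
facet of a nondegenerate simplex). -/
def outwardNormal (K F : Finset (E d)) : E d := by
  classical exact if h : ∃ ν, IsOutwardNormal K F ν then h.choose else 0

/-! ### Integrals of broken functions

A broken function is a family of functions, one for every mesh element. -/

/-- `∫_Ω g dx` for a broken function `g`, that is, the sum of the integrals over the elements. -/
def volInt (T : Triangulation d Ω) (g : Cell T → E d → ℝ) : ℝ :=
  ∑ K : Cell T, ∫ x in openCell T K, g K x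

/-- `∫_e g ds`: integral over a facet with respect to the surface measure, i.e. the
`(d-1)`-dimensional Euclidean Hausdorff measure. -/
def facetInt (F : Finset (E d)) (g : E d → ℝ) : ℝ :=
  ∫ x in convexHull ℝ (F : Set (E d)), g x ∂μHE[d - 1]

/-- The surface measure `|e|` of a facet. -/
def facetArea (F : Finset (E d)) : ℝ :=
  (μHE[d - 1] (convexHull ℝ (F : Set (E d)))).toReal

/-- The sum over all interfaces of the facet integrals. -/
def interfaceInt (T : Triangulation d Ω) (g : Finset (E d) → E d → ℝ) : ℝ :=
  ∑ F ∈ interfaces T, facetInt F (g F)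

/-- The sum over all interfaces and all boundary facets of the facet integrals. -/
def allFacesInt (T : Triangulation d Ω) (g : Finset (E d) → E d → ℝ) : ℝ :=
  ∑ F ∈ allFaces T, facetInt F (g F)

/-! ### Averages and jumps

On an interface the sums below run over the two adjacent elements, on a boundary facet over the
single adjacent element. -/

/-- The average `{Φ}` (of a scalar-, vector- or matrix-valued broken function). -/
def avg (T : Triangulation d Ω) {M : Type} [AddCommGroup M] [Module ℝ M]
    (F : Finset (E d)) (g : Cell T → E d → M) (x : E d) : M :=
  ((adj T F).card : ℝ)⁻¹ • ∑ K ∈ adj T F, g K x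

/-- The (vector-valued) jump `[Φ] = ∑ Φ|_K n_K` of a scalar broken function. -/
def jump (T : Triangulation d Ω) (F : Finset (E d)) (g : Cell T → E d → ℝ) (x : E d) :
    Fin d → ℝ :=
  fun i => ∑ K ∈ adj T F, g K x * outwardNormal K.1 F i

/-- The (scalar) jump `[u] = ∑ u|_K · n_K` of a vector-valued broken function. -/
def jumpVec (T : Triangulation d Ω) (F : Finset (E d)) (u : Cell T → E d → Fin d → ℝ)
    (x : E d) : ℝ :=
  ∑ K ∈ adj T F, ∑ i, u K x i * outwardNormal K.1 F i

/-- The tensor jump `[u]_⊗ = ∑ u|_K ⊗ n_K` of a vector-valued broken function. -/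
def jumpTensor (T : Triangulation d Ω) (F : Finset (E d)) (u : Cell T → E d → Fin d → ℝ)
    (x : E d) : Matrix (Fin d) (Fin d) ℝ :=
  Matrix.of fun i j => ∑ K ∈ adj T F, u K x i * outwardNormal K.1 F j

/-- The contraction `A : B`. -/
def contract (A B : Matrix (Fin d) (Fin d) ℝ) : ℝ := ∑ i, ∑ j, A i j * B i j

/-! ### Broken polynomials and the discrete spaces -/

/-- Broken polynomials: one polynomial for every mesh element (with pointwise ring operations). -/
abbrev BPoly (T : Triangulation d Ω) : Type := Cell T → MvPolynomial (Fin d) ℝ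

/-- The values of a broken polynomial. On the boundary of an element this is its one-sided
trace. -/
def ev {T : Triangulation d Ω} (p : BPoly T) (K : Cell T) (x : E d) : ℝ :=
  MvPolynomial.eval (fun i => x i) (p K)

/-- The values of a vector of broken polynomials. -/
def evVec {T : Triangulation d Ω} (u : Fin d → BPoly T) (K : Cell T) (x : E d) : Fin d → ℝ :=
  fun i => ev (u i) K x

/-- The elementwise partial derivative `∂_i`. -/
def D {T : Triangulation d Ω} (i : Fin d) (p : BPoly T) : BPoly T :=
  fun K => MvPolynomial.pderiv i (p K)

/-- The elementwise divergence. -/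
def divg {T : Triangulation d Ω} (u : Fin d → BPoly T) : BPoly T := ∑ i, D i (u i)

/-- The values of the elementwise Jacobian `(∇u)_{ij} = ∂_j u_i`. -/
def gradVec {T : Triangulation d Ω} (u : Fin d → BPoly T) (K : Cell T) (x : E d) :
    Matrix (Fin d) (Fin d) ℝ :=
  Matrix.of fun i j => ev (D j (u i)) K x

/-- `V_h`: broken polynomials of degree at most `k`. -/
def Vh (T : Triangulation d Ω) (k : ℕ) : Set (BPoly T) :=
  {u | ∀ K, (u K).totalDegree ≤ k}

/-- `(V_{h,0})^d`: vector-valued, zero trace on `∂Ω`. -/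
def VhZero (T : Triangulation d Ω) (k : ℕ) : Set (Fin d → BPoly T) :=
  {v | (∀ i, v i ∈ Vh T k) ∧ ∀ F ∈ boundaryFacets T, ∀ K ∈ adj T F,
    ∀ x ∈ convexHull ℝ (F : Set (E d)), ∀ i, ev (v i) K x = 0}

/-- `V_{h,n}`: vector-valued, zero normal trace on `∂Ω`. -/
def VhNormal (T : Triangulation d Ω) (k : ℕ) : Set (Fin d → BPoly T) :=
  {s | (∀ i, s i ∈ Vh T k) ∧ ∀ F ∈ boundaryFacets T, ∀ K ∈ adj T F,
    ∀ x ∈ convexHull ℝ (F : Set (E d)), ∑ i, ev (s i) K x * outwardNormal K.1 F i = 0}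

/-- Six-tuples `(ρ, v, φ, μ, τ, σ)` of broken polynomials. -/
abbrev State (T : Triangulation d Ω) : Type :=
  BPoly T × (Fin d → BPoly T) × BPoly T × BPoly T × BPoly T × (Fin d → BPoly T)

namespace State
variable {T : Triangulation d Ω}
def rho (U : State T) : BPoly T := U.1
def vel (U : State T) : Fin d → BPoly T := U.2.1
def phi (U : State T) : BPoly T := U.2.2.1
def mu (U : State T) : BPoly T := U.2.2.2.1
def tau (U : State T) : BPoly T := U.2.2.2.2.1
def sig (U : State T) : Fin d → BPoly T := U.2.2.2.2.2
end State

/-- `𝒱_h = V_h × (V_{h,0})^d × V_h × V_h × V_h × V_{h,n}`. -/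
def StateSpace (T : Triangulation d Ω) (k : ℕ) : Set (State T) :=
  {U | U.rho ∈ Vh T k ∧ U.vel ∈ VhZero T k ∧ U.phi ∈ Vh T k ∧ U.mu ∈ Vh T k ∧
    U.tau ∈ Vh T k ∧ U.sig ∈ VhNormal T k}

/-! ### Initial data and the `L²`-projection -/

/-- Initial functions `(ρ₀, v₀, φ₀, μ₀, τ₀, σ₀)` in `L²(Ω)`. -/
structure InitialData (Ω : Set (E d)) where
  rho : E d → ℝ
  vel : E d → Fin d → ℝ
  phi : E d → ℝ
  mu : E d → ℝ
  tau : E d → ℝ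
  sig : E d → Fin d → ℝ
  rho_mem : MeasureTheory.MemLp rho 2 (MeasureTheory.volume.restrict Ω)
  vel_mem : ∀ i, MeasureTheory.MemLp (fun x => vel x i) 2 (MeasureTheory.volume.restrict Ω)
  phi_mem : MeasureTheory.MemLp phi 2 (MeasureTheory.volume.restrict Ω)
  mu_mem : MeasureTheory.MemLp mu 2 (MeasureTheory.volume.restrict Ω)
  tau_mem : MeasureTheory.MemLp tau 2 (MeasureTheory.volume.restrict Ω)
  sig_mem : ∀ i, MeasureTheory.MemLp (fun x => sig x i) 2 (MeasureTheory.volume.restrict Ω)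

/-- `u - f` is `L²`-orthogonal to `V_h`. -/
def IsProjScalar (T : Triangulation d Ω) (k : ℕ) (f : E d → ℝ) (u : BPoly T) : Prop :=
  ∀ ψ ∈ Vh T k, volInt T (fun K x => ev u K x * ev ψ K x) =
    volInt T (fun K x => f x * ev ψ K x)

/-- `u - f` is `L²`-orthogonal to the space `W` of vector-valued broken polynomials. -/
def IsProjVec (T : Triangulation d Ω) (W : Set (Fin d → BPoly T)) (f : E d → Fin d → ℝ)
    (u : Fin d → BPoly T) : Prop :=
  ∀ X ∈ W, volInt T (fun K x => evVec u K x ⬝ᵥ evVec X K x) =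
    volInt T (fun K x => f x ⬝ᵥ evVec X K x)

/-- `U = Π_h U₀`, where `Π_h` is the `L²`-projection onto `𝒱_h`. -/
def IsL2Projection (T : Triangulation d Ω) (k : ℕ) (U₀ : InitialData Ω) (U : State T) : Prop :=
  U ∈ StateSpace T k ∧
  IsProjScalar T k U₀.rho U.rho ∧ IsProjVec T (VhZero T k) U₀.vel U.vel ∧
  IsProjScalar T k U₀.phi U.phi ∧ IsProjScalar T k U₀.mu U.mu ∧
  IsProjScalar T k U₀.tau U.tau ∧ IsProjVec T (VhNormal T k) U₀.sig U.sig

/-! ### Constitutive data, viscous form, energy -/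

/-- Constitutive data: the function `f̃(ρ, φ)`, the two viscosities as functions of `φ`, the
capillarity `γ`, the mobility `η`, the interior penalty parameter `α_B`. -/
structure Params where
  ftilde : ℝ → ℝ → ℝ
  visc₁ : ℝ → ℝ
  visc₂ : ℝ → ℝ
  gamma : ℝ
  eta : ℝ
  alphaB : ℝ

/-- The energy density `ρ f̃(ρ, φ)`. -/
def Params.dens (P : Params) (r p : ℝ) : ℝ := r * P.ftilde r p

/-- The Newtonian viscous stress `S(∇v, φ) = ν₁(φ) (∇v + ∇vᵀ) + ν₂(φ) div(v) I`. -/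
def Params.stress (P : Params) (G : Matrix (Fin d) (Fin d) ℝ) (p : ℝ) :
    Matrix (Fin d) (Fin d) ℝ :=
  P.visc₁ p • (G + Gᵀ) + (P.visc₂ p * G.trace) • (1 : Matrix (Fin d) (Fin d) ℝ)

/-- The broken function `S(∇v, φ)`. -/
def stressField {T : Triangulation d Ω} (P : Params) (φ : BPoly T) (v : Fin d → BPoly T)
    (K : Cell T) (x : E d) : Matrix (Fin d) (Fin d) ℝ :=
  P.stress (gradVec v K x) (ev φ K x)

/-- The symmetric interior penalty form `B_h[φ; v, X]`. -/
def Bh (T : Triangulation d Ω) (P : Params) (φ : BPoly T) (v X : Fin d → BPoly T) : ℝ :=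
  volInt T (fun K x => contract (stressField P φ v K x) (gradVec X K x))
  - allFacesInt T (fun F x =>
      contract (avg T F (stressField P φ v) x) (jumpTensor T F (evVec X) x)
      + contract (avg T F (stressField P φ X) x) (jumpTensor T F (evVec v) x))
  + allFacesInt T (fun F x => P.alphaB / facetArea F *
      contract (jumpTensor T F (evVec v) x) (jumpTensor T F (evVec X) x))

/-- The discrete energy `∫ ρ f̃(ρ, φ) + γ/2 |σ|² + ρ/2 |v|²`. -/
def energy (T : Triangulation d Ω) (P : Params) (U : State T) : ℝ :=
  volInt T (fun K x => P.dens (ev U.rho K x) (ev U.phi K x)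
    + P.gamma / 2 * (evVec U.sig K x ⬝ᵥ evVec U.sig K x)
    + ev U.rho K x / 2 * (evVec U.vel K x ⬝ᵥ evVec U.vel K x))

/-! ### The fully discrete scheme -/

/-- The discrete `φ`-derivative of `ρ f̃`,
`(F(ρ₁,φ₁) - F(ρ₁,φ₀) + F(ρ₀,φ₁) - F(ρ₀,φ₀)) / (2 (φ₁ - φ₀))` with `F(ρ,φ) = ρ f̃(ρ,φ)`;
where `φ₁ = φ₀` the difference quotients are read as derivatives. -/
def Params.dqPhi (P : Params) (r₀ p₀ r₁ p₁ : ℝ) : ℝ :=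
  (dslope (fun p => P.dens r₁ p) p₀ p₁ + dslope (fun p => P.dens r₀ p) p₀ p₁) / 2

/-- The discrete `ρ`-derivative of `ρ f̃`,
`(F(ρ₁,φ₁) - F(ρ₀,φ₁) + F(ρ₁,φ₀) - F(ρ₀,φ₀)) / (2 (ρ₁ - ρ₀))`;
where `ρ₁ = ρ₀` the difference quotients are read as derivatives. -/
def Params.dqRho (P : Params) (r₀ p₀ r₁ p₁ : ℝ) : ℝ :=
  (dslope (fun r => P.dens r p₁) r₀ r₁ + dslope (fun r => P.dens r p₀) r₀ r₁) / 2

/-- `dqPhi` for two states, as a broken function. -/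
def dqPhiField {T : Triangulation d Ω} (P : Params) (U₀ U₁ : State T) (K : Cell T) (x : E d) : ℝ :=
  P.dqPhi (ev U₀.rho K x) (ev U₀.phi K x) (ev U₁.rho K x) (ev U₁.phi K x)

/-- `dqRho` for two states, as a broken function. -/
def dqRhoField {T : Triangulation d Ω} (P : Params) (U₀ U₁ : State T) (K : Cell T) (x : E d) : ℝ :=
  P.dqRho (ev U₀.rho K x) (ev U₀.phi K x) (ev U₁.rho K x) (ev U₁.phi K x)

/-- The midpoint `U^{n+1/2} = (U^n + U^{n+1}) / 2`. -/
def mid {T : Triangulation d Ω} (U₀ U₁ : State T) : State T := (1 / 2 : ℝ) • (U₀ + U₁)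

/-- Mass equation. -/
def EqRho (T : Triangulation d Ω) (k : ℕ) (δ : ℝ) (U₀ U₁ : State T) : Prop :=
  let U := mid U₀ U₁
  ∀ ψ ∈ Vh T k,
    0 = volInt T (fun K x =>
          ((ev U₁.rho K x - ev U₀.rho K x) / δ + ev (divg (fun i => U.rho * U.vel i)) K x)
            * ev ψ K x)
      - interfaceInt T (fun F x =>
          jumpVec T F (evVec (fun i => U.rho * U.vel i)) x * avg T F (ev ψ) x)

/-- Momentum equation. -/
def EqVel (T : Triangulation d Ω) (k : ℕ) (P : Params) (δ : ℝ) (U₀ U₁ : State T) : Prop :=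
  let U := mid U₀ U₁
  ∀ X ∈ VhZero T k,
    0 = volInt T (fun K x => ∑ i,
          (ev U.rho K x * ((ev (U₁.vel i) K x - ev (U₀.vel i) K x) / δ)
            + ev (divg (fun j => U.rho * U.vel i * U.vel j)) K x
            - ev (divg (fun j => U.rho * U.vel j)) K x * ev (U.vel i) K x
            - 1 / 2 * ev U.rho K x * ev (D i (∑ j, U.vel j * U.vel j)) K x
            + ev U.rho K x * ev (D i U.tau) K x
            - ev U.mu K x * ev (D i U.phi) K x) * ev (X i) K x)
      - interfaceInt T (fun F x =>
          jump T F (ev U.tau) x ⬝ᵥ avg T F (evVec (fun i => U.rho * X i)) x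
          - jump T F (ev U.phi) x ⬝ᵥ avg T F (evVec (fun i => U.mu * X i)) x)
      + Bh T P U.phi U.vel X

/-- Phase field equation. -/
def EqPhi (T : Triangulation d Ω) (k : ℕ) (P : Params) (δ : ℝ) (U₀ U₁ : State T) : Prop :=
  let U := mid U₀ U₁
  ∀ Θ ∈ Vh T k,
    0 = volInt T (fun K x =>
          ((ev U₁.phi K x - ev U₀.phi K x) / δ
            + ∑ i, ev (D i U.phi) K x * ev (U.vel i) K x
            + P.eta * (ev U.mu K x / ev U.rho K x)) * ev Θ K x)
      - interfaceInt T (fun F x =>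
          jump T F (ev U.phi) x ⬝ᵥ avg T F (evVec (fun i => Θ * U.vel i)) x)

/-- Equation for `μ`. -/
def EqMu (T : Triangulation d Ω) (k : ℕ) (P : Params) (U₀ U₁ : State T) : Prop :=
  let U := mid U₀ U₁
  ∀ χ ∈ Vh T k,
    0 = volInt T (fun K x =>
          (ev U.mu K x - dqPhiField P U₀ U₁ K x + P.gamma * ev (divg U.sig) K x) * ev χ K x)
      - interfaceInt T (fun F x =>
          P.gamma * jumpVec T F (evVec U.sig) x * avg T F (ev χ) x)

/-- Equation for `τ`. -/
def EqTau (T : Triangulation d Ω) (k : ℕ) (P : Params) (U₀ U₁ : State T) : Prop :=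
  let U := mid U₀ U₁
  ∀ ζ ∈ Vh T k,
    0 = volInt T (fun K x =>
          (ev U.tau K x - dqRhoField P U₀ U₁ K x
            - 1 / 4 * (evVec U₁.vel K x ⬝ᵥ evVec U₁.vel K x
                + evVec U₀.vel K x ⬝ᵥ evVec U₀.vel K x)) * ev ζ K x)

/-- Equation for `σ`: `σ` is the discrete gradient of `φ`. -/
def EqSig (T : Triangulation d Ω) (k : ℕ) (U : State T) : Prop :=
  ∀ Z ∈ VhNormal T k,
    0 = volInt T (fun K x =>
          ∑ i, (ev (U.sig i) K x - ev (D i U.phi) K x) * ev (Z i) K x)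
      + interfaceInt T (fun F x => jump T F (ev U.phi) x ⬝ᵥ avg T F (evVec Z) x)

/-- The broken function `g` of time belongs to `C⁰([0, tEnd]; L²(Ω))`. -/
def ContinuousInL2 (T : Triangulation d Ω) (tEnd : ℝ) (g : ℝ → Cell T → E d → ℝ) : Prop :=
  ∀ K, (∀ s ∈ Set.Icc 0 tEnd,
      MeasureTheory.MemLp (g s K) 2 (MeasureTheory.volume.restrict (openCell T K))) ∧
    ∀ s₀ ∈ Set.Icc 0 tEnd, Filter.Tendsto
      (fun s => MeasureTheory.eLpNorm (g s K - g s₀ K) 2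
        (MeasureTheory.volume.restrict (openCell T K)))
      (𝓝[Set.Icc 0 tEnd] s₀) (𝓝 0)

/-- `U : [0, t_N] → 𝒱_h` is a fully discrete dG approximation with initial functions `Uinit`, on the
time grid `0 = t_0 < ... < t_N`. -/
structure IsFullyDiscrete (T : Triangulation d Ω) (k : ℕ) (P : Params) (Uinit : InitialData Ω)
    (N : ℕ) (t : ℕ → ℝ) (U : ℝ → State T) : Prop where
  mem : ∀ s ∈ Set.Icc 0 (t N), U s ∈ StateSpace T k
  init : IsL2Projection T k Uinit (U 0)
  interpolates : ∀ n < N, ∀ s ∈ Set.Icc (t n) (t (n + 1)),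
    U s = ((s - t n) / (t (n + 1) - t n)) • (U (t (n + 1)) - U (t n)) + U (t n)
  bounds : ∀ s ∈ Set.Icc 0 (t N), ∀ K,
    ∀ᵐ x ∂(MeasureTheory.volume.restrict (openCell T K)),
      0 < ev (U s).rho K x ∧ ev (U s).phi K x ∈ Set.Icc (0 : ℝ) 1
  inv_rho : ContinuousInL2 T (t N) (fun s K x => (ev (U s).rho K x)⁻¹)
  dens : ContinuousInL2 T (t N) (fun s K x => P.dens (ev (U s).rho K x) (ev (U s).phi K x))
  kinetic : ContinuousInL2 T (t N) (fun s K x =>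
    ev (U s).rho K x * (evVec (U s).vel K x ⬝ᵥ evVec (U s).vel K x))
  /-- The volume integrals in the equations for `μ` and `τ` are well defined. -/
  integrable : ∀ n < N, ∀ K,
    MeasureTheory.IntegrableOn (dqPhiField P (U (t n)) (U (t (n + 1))) K) (openCell T K) ∧
    MeasureTheory.IntegrableOn (dqRhoField P (U (t n)) (U (t (n + 1))) K) (openCell T K)
  eq_rho : ∀ n < N, EqRho T k (t (n + 1) - t n) (U (t n)) (U (t (n + 1)))
  eq_vel : ∀ n < N, EqVel T k P (t (n + 1) - t n) (U (t n)) (U (t (n + 1)))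
  eq_phi : ∀ n < N, EqPhi T k P (t (n + 1) - t n) (U (t n)) (U (t (n + 1)))
  eq_mu : ∀ n < N, EqMu T k P (U (t n)) (U (t (n + 1)))
  eq_tau : ∀ n < N, EqTau T k P (U (t n)) (U (t (n + 1)))
  eq_sig : ∀ n < N, EqSig T k (U (t (n + 1)))

end NSAC

end

/-! Both claims follow by testing the scheme with admissible discrete functions, and the energy law
even holds with equality (`energy_balance`). At one time step, with midpoint values written without
superscript, test the mass equation with `τ`, the momentum equation with `v`, the phase field
equation with `μ`, the equation for `μ` with `φ^{n+1} - φ^n`, the equation for `τ` with `ρ^{n+1} -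
ρ^n`, and the difference of the gradient relations at the two time levels with `σ`.

Three algebraic facts make the volume terms fit together. The two difference quotients satisfy an
exact chain rule for `F` (`Params.discrete_chain_rule`). The convective terms vanish pointwise when
contracted with `v` (`convection_dot_self`). Finally, `ρ (|v^{n+1}|² - |v^n|²)/2` plus `(ρ^{n+1} -
ρ^n)(|v^{n+1}|² + |v^n|²)/4` is exactly the increment of `ρ|v|²/2`, which explains the factor 1/4 in
the equation for `τ`.

What is left are divergence terms and interface terms. They cancel by elementwise integration by
parts (`volInt_integration_by_parts`), whose jump terms come from `[p u] = [p]·{u} + [u]{p}`. Mass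
conservation is the same argument with test function 1: the total divergence of `ρv` equals its
total jump (`volInt_divg`), and between time nodes the mass is affine.

Integration by parts rests on two geometric facts. One is the divergence theorem on a simplex with
Hausdorff surface measure (`setIntegral_fderiv_simplex`): the simplex is a cone over each of its
facets, the theorem for a field pointing away from the apex is a one-dimensional integration along
rays, and a constant direction is a combination of such radial fields. The other is mesh
combinatorics: conformity makes the two normals on an interface opposite, and a facet that is not an
interface lies in `∂Ω`, where the trace conditions remove its contribution. -/

noncomputable section

namespace NSAC
open MeasureTheory

/-! ### Surface measure on hyperplanes and integration over cones -/

/-- Cartesian coordinates adapted to a unit vector `n`: a linear isometric parametrization of the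
hyperplane orthogonal to `n`, together with the volume preserving splitting it induces. -/
theorem exists_isometry_hyperplane {m : ℕ} (n : E (m + 1)) (hn : ‖n‖ = 1) :
    ∃ j : E m →ₗᵢ[ℝ] E (m + 1), (∀ z, inner ℝ n (j z) = 0) ∧
      (∀ w, inner ℝ n w = 0 → ∃ z, j z = w) ∧
      MeasurePreserving (fun p : ℝ × E m => p.1 • n + j p.2)
        ((volume : Measure ℝ).prod (volume : Measure (E m))) volume := by
  -- Only the value of the constant family at index 0 is prescribed; the other basis vectors are
  -- free.
  obtain ⟨b, hb⟩ := Orthonormal.exists_orthonormalBasis_extension_of_card_eq (𝕜 := ℝ)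
    (E := E (m + 1)) (ι := Fin (m + 1)) (by simp) (v := fun _ => n) (s := {0}) (by
      refine ⟨fun i => hn, fun i k hik => (hik (Subsingleton.elim _ _)).elim⟩)
  have hb0 : b 0 = n := hb 0 rfl
  let f : E m →ₗ[ℝ] E (m + 1) :=
    { toFun := fun z => b.repr.symm (WithLp.toLp 2 (Fin.cons 0 fun i => z i))
      map_add' := fun x y => by
        rw [← map_add]; congr 1; ext i
        refine Fin.cases ?_ (fun i => ?_) i <;> simp
      map_smul' := fun c x => by
        rw [← map_smul]; congr 1; ext i
        refine Fin.cases ?_ (fun i => ?_) i <;> simp }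
  have hf : ∀ z, f z = b.repr.symm (WithLp.toLp 2 (Fin.cons 0 fun i => z i)) := fun _ => rfl
  have hinner : ∀ w, inner ℝ n w = b.repr w 0 := fun w => by
    rw [b.repr_apply_apply, hb0]
  refine ⟨⟨f, fun z => ?_⟩, fun z => ?_, fun w hw => ?_, ?_⟩
  · rw [hf, LinearIsometryEquiv.norm_map, EuclideanSpace.norm_eq, EuclideanSpace.norm_eq,
      Fin.sum_univ_succ]
    simp
  · change inner ℝ n (f z) = 0
    rw [hinner, hf]; simp
  · refine ⟨WithLp.toLp 2 fun i => b.repr w i.succ, ?_⟩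
    change f _ = w
    rw [hf, LinearIsometryEquiv.symm_apply_eq]
    ext i
    refine Fin.cases ?_ (fun i => ?_) i
    · simpa [hinner] using hw.symm
    · simp
  · have h1 : MeasurePreserving (fun p : ℝ × E m => (p.1, WithLp.ofLp p.2))
        ((volume : Measure ℝ).prod (volume : Measure (E m)))
        ((volume : Measure ℝ).prod (volume : Measure (Fin m → ℝ))) :=
      (MeasurePreserving.id _).prod (PiLp.volume_preserving_ofLp (Fin m))
    have h2 := (volume_preserving_piFinSuccAbove (fun _ : Fin (m + 1) => ℝ) 0).symm
    have h3 := PiLp.volume_preserving_toLp (Fin (m + 1))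
    have h4 := b.measurePreserving_repr_symm
    have h := h4.comp (h3.comp (h2.comp h1))
    convert h using 1
    funext p
    change p.1 • n + f p.2 = b.repr.symm _
    rw [LinearIsometryEquiv.eq_symm_apply, map_add, map_smul, hf,
      LinearIsometryEquiv.apply_symm_apply, ← hb0, b.repr_self]
    ext i
    refine Fin.cases ?_ (fun i => ?_) i <;>
      simp [MeasurableEquiv.piFinSuccAbove_symm_apply, Fin.insertNthEquiv]

/-- The surface integral over a subset of a hyperplane, in Cartesian coordinates. -/
theorem setIntegral_euclideanHausdorff_hyperplane {m : ℕ} (n : E (m + 1))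
    (j : E m →ₗᵢ[ℝ] E (m + 1)) (hj : ∀ w, inner ℝ n w = 0 → ∃ z, j z = w) (x₀ : E (m + 1))
    {F : Set (E (m + 1))} (hF : ∀ x ∈ F, inner ℝ n (x - x₀) = 0) (hFm : MeasurableSet F)
    (g : E (m + 1) → ℝ) :
    ∫ x in F, g x ∂μHE[m] = ∫ z, F.indicator g (x₀ + j z) := by
  have hiso : Isometry (fun z : E m => x₀ + j z) :=
    (IsometryEquiv.addLeft x₀).isometry.comp j.isometry
  have hemb : MeasurableEmbedding (fun z : E m => x₀ + j z) :=
    hiso.isClosedEmbedding.measurableEmbedding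
  have hmap := hiso.map_euclideanHausdorffMeasure (d := m)
  have hsub : F ⊆ Set.range (fun z : E m => x₀ + j z) := fun x hx => by
    obtain ⟨z, hz⟩ := hj _ (hF x hx)
    exact ⟨z, by simp [hz]⟩
  rw [EuclideanSpace.euclideanHausdorffMeasure_eq_volume] at hmap
  rw [← integral_indicator hFm, ← hemb.integral_map, hmap,
    ← integral_indicator hemb.measurableSet_range, Set.indicator_indicator,
    Set.inter_eq_right.mpr hsub]

/-- An isometric chart of the hyperplane pulls `F` back to a compact set in `E m`, where the measure
is Lebesgue measure. This makes continuous functions integrable over facets. -/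
theorem euclideanHausdorff_lt_top_of_isCompact {m : ℕ} (n : E (m + 1)) (hn : ‖n‖ = 1)
    (x₀ : E (m + 1)) {F : Set (E (m + 1))} (hF : ∀ x ∈ F, inner ℝ n (x - x₀) = 0)
    (hFc : IsCompact F) : (μHE[m] : Measure (E (m + 1))) F < ⊤ := by
  obtain ⟨j, -, hj, -⟩ := exists_isometry_hyperplane n hn
  have hiso : Isometry (fun z : E m => x₀ + j z) :=
    (IsometryEquiv.addLeft x₀).isometry.comp j.isometry
  have hsub : F ⊆ Set.range (fun z : E m => x₀ + j z) := fun x hx => by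
    obtain ⟨z, hz⟩ := hj _ (hF x hx)
    exact ⟨z, by simp [hz]⟩
  have h := hiso.euclideanHausdorffMeasure_preimage (d := m) F
  rw [Set.inter_eq_left.mpr hsub, EuclideanSpace.euclideanHausdorffMeasure_eq_volume] at h
  rw [← h]
  exact (hiso.isClosedEmbedding.isCompact_preimage hFc).measure_lt_top

/-- Integration over a cone with apex `a` over a flat base `F` at height `h`. -/
theorem setIntegral_cone {m : ℕ} (n : E (m + 1)) (hn : ‖n‖ = 1) (a : E (m + 1)) {h : ℝ}
    (hh : 0 < h) {K F : Set (E (m + 1))} (hK : IsCompact K) (hFc : IsCompact F)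
    (hKn : ∀ x ∈ K, 0 ≤ inner ℝ n (x - a) ∧ inner ℝ n (x - a) ≤ h)
    (hFn : ∀ x ∈ F, inner ℝ n (x - a) = h)
    (hKF : ∀ s : ℝ, 0 < s → s ≤ 1 → ∀ w, inner ℝ n w = h → (a + s • w ∈ K ↔ a + w ∈ F))
    (q : E (m + 1) → ℝ) (hq : Continuous q) :
    ∫ x in K, q x = h * ∫ s in (0 : ℝ)..1, s ^ m * ∫ y in F, q (a + s • (y - a)) ∂μHE[m] := by
  obtain ⟨j, hj0, hj, hmp⟩ := exists_isometry_hyperplane n hn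
  have hnn : inner ℝ n n = (1 : ℝ) := by rw [real_inner_self_eq_norm_sq, hn]; norm_num
  have hmp' : MeasurePreserving (fun p : ℝ × E m => a + (p.1 • n + j p.2))
      ((volume : Measure ℝ).prod (volume : Measure (E m))) volume :=
    (measurePreserving_add_left volume a).comp hmp
  have hint : Integrable (K.indicator q) :=
    (integrable_indicator_iff hK.measurableSet).mpr (hq.continuousOn.integrableOn_compact hK)
  have e1 : ∫ x in K, q x = ∫ r : ℝ, ∫ z : E m, K.indicator q (a + (r • n + j z)) := by
    rw [← integral_indicator hK.measurableSet]
    have hi := (hmp'.integrable_comp hint.aestronglyMeasurable).mpr hint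
    have := integral_prod _ hi
    rw [Function.comp_def] at this
    rw [← this, ← hmp'.map_eq, integral_map hmp'.measurable.aemeasurable]
    rw [hmp'.map_eq]; exact hint.aestronglyMeasurable
  -- The slice of the cone at height `h * s` is the base scaled by `s` about the apex; scaling in
  -- dimension `m` produces the weight `s ^ m`.
  have e2 : ∀ s : ℝ, 0 < s → s ≤ 1 → ∫ z : E m, K.indicator q (a + ((h * s) • n + j z)) =
      s ^ m * ∫ y in F, q (a + s • (y - a)) ∂μHE[m] := by
    intro s hs hs1
    rw [setIntegral_euclideanHausdorff_hyperplane n j hj (a + h • n)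
      (fun x hx => by
        have := hFn x hx
        rw [← sub_sub, inner_sub_right, this, inner_smul_right, hnn]; ring) hFc.measurableSet]
    have := Measure.integral_comp_smul (volume : Measure (E m))
      (fun z => K.indicator q (a + ((h * s) • n + j z))) s
    rw [finrank_euclideanSpace_fin, abs_of_pos (by positivity), smul_eq_mul] at this
    have h2 : (fun z : E m => K.indicator q (a + ((h * s) • n + j (s • z)))) =
        fun z => F.indicator (fun y => q (a + s • (y - a))) (a + h • n + j z) := by
      funext z
      have hw : inner ℝ n (h • n + j z) = h := by
        rw [inner_add_right, inner_smul_right, hnn, hj0]; ring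
      have hpt : a + ((h * s) • n + j (s • z)) = a + s • (h • n + j z) := by
        rw [map_smul]; module
      have hiff := hKF s hs hs1 _ hw
      rw [hpt, add_assoc]
      by_cases hm : a + (h • n + j z) ∈ F
      · rw [Set.indicator_of_mem hm, Set.indicator_of_mem (hiff.mpr hm)]; simp
      · rw [Set.indicator_of_notMem hm, Set.indicator_of_notMem (fun hc => hm (hiff.mp hc))]
    rw [← h2, this]
    field_simp
  have e3 : ∀ s : ℝ, (s < 0 ∨ 1 < s) →
      ∫ z : E m, K.indicator q (a + ((h * s) • n + j z)) = 0 := by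
    intro s hs
    have : ∀ z : E m, K.indicator q (a + ((h * s) • n + j z)) = 0 := fun z => by
      refine Set.indicator_of_notMem (fun hc => ?_) _
      have := hKn _ hc
      rw [add_sub_cancel_left, inner_add_right, inner_smul_right, hnn, hj0] at this
      rcases hs with hs | hs <;> nlinarith
    simp [this]
  have e4 := Measure.integral_comp_mul_left
    (fun r : ℝ => ∫ z : E m, K.indicator q (a + (r • n + j z))) h
  rw [abs_of_pos (by positivity), smul_eq_mul] at e4
  have e5 : ∫ x in K, q x = h * ∫ s : ℝ, ∫ z : E m, K.indicator q (a + ((h * s) • n + j z)) := by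
    rw [e1, e4]; field_simp
  rw [e5, intervalIntegral.integral_of_le zero_le_one, ← integral_indicator measurableSet_Ioc]
  congr 1
  refine integral_congr_ae ?_
  -- The slice at the apex is described neither by `e2` nor by `e3`, but a single height is
  -- negligible.
  have h0 : ∀ᵐ s : ℝ, s ≠ 0 := by simp [ae_iff]
  filter_upwards [h0] with s hs
  by_cases hm : s ∈ Set.Ioc (0 : ℝ) 1
  · rw [Set.indicator_of_mem hm, e2 s hm.1 hm.2]
  · rw [Set.indicator_of_notMem hm]
    apply e3
    rcases lt_or_gt_of_ne hs with h | h
    · exact Or.inl h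
    · right; by_contra hc; exact hm ⟨h, not_lt.mp hc⟩

/-- The divergence theorem on a cone for a field pointing away from its apex. -/
theorem setIntegral_radial {m : ℕ} (n : E (m + 1)) (hn : ‖n‖ = 1) (a : E (m + 1)) {h : ℝ}
    (hh : 0 < h) {K F : Set (E (m + 1))} (hK : IsCompact K) (hFc : IsCompact F)
    (hKn : ∀ x ∈ K, 0 ≤ inner ℝ n (x - a) ∧ inner ℝ n (x - a) ≤ h)
    (hFn : ∀ x ∈ F, inner ℝ n (x - a) = h)
    (hKF : ∀ s : ℝ, 0 < s → s ≤ 1 → ∀ w, inner ℝ n w = h → (a + s • w ∈ K ↔ a + w ∈ F))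
    (p : E (m + 1) → ℝ) (hp : ContDiff ℝ 1 p) :
    ∫ x in K, ((m + 1) * p x + fderiv ℝ p x (x - a)) = h * ∫ y in F, p y ∂μHE[m] := by
  have hp' : Continuous (fun x => fderiv ℝ p x) := hp.continuous_fderiv one_ne_zero
  have hq : Continuous (fun x => (m + 1) * p x + fderiv ℝ p x (x - a)) :=
    (continuous_const.mul hp.continuous).add (hp'.clm_apply (continuous_id.sub continuous_const))
  rw [setIntegral_cone n hn a hh hK hFc hKn hFn hKF _ hq]
  congr 1
  -- The surface measure is not σ-finite on the whole space; its restriction to the flat compact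
  -- base is finite, as Fubini's theorem below requires.
  have hfin : IsFiniteMeasure ((μHE[m] : Measure (E (m + 1))).restrict F) := by
    refine ⟨?_⟩
    rw [Measure.restrict_apply_univ]
    rcases F.eq_empty_or_nonempty with rfl | ⟨x₀, hx₀⟩
    · simp
    · refine euclideanHausdorff_lt_top_of_isCompact n hn x₀ (fun x hx => ?_) hFc
      rw [show x - x₀ = (x - a) - (x₀ - a) by abel, inner_sub_right, hFn x hx, hFn x₀ hx₀, sub_self]
  let G : ℝ → E (m + 1) → ℝ := fun s y => s ^ m * ((m + 1) * p (a + s • (y - a)) +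
      fderiv ℝ p (a + s • (y - a)) (a + s • (y - a) - a))
  have hG : Continuous (Function.uncurry G) := by
    have hc : Continuous (fun z : ℝ × E (m + 1) => a + z.1 • (z.2 - a)) := by fun_prop
    exact (continuous_fst.pow m).mul (hq.comp hc)
  have hint : Integrable (Function.uncurry G)
      ((volume.restrict (Set.uIoc (0 : ℝ) 1)).prod ((μHE[m] : Measure (E (m + 1))).restrict F)) := by
    obtain ⟨C, hC⟩ := ((isCompact_Icc (a := (0 : ℝ)) (b := 1)).prod hFc).exists_bound_of_continuousOn
      hG.continuousOn
    have : IsFiniteMeasure ((volume : Measure ℝ).restrict (Set.uIoc (0 : ℝ) 1)) := by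
      rw [Set.uIoc_of_le zero_le_one]; infer_instance
    refine Integrable.of_bound hG.aestronglyMeasurable C ?_
    have h1 : ∀ᵐ z ∂((volume.restrict (Set.uIoc (0 : ℝ) 1)).prod
        ((μHE[m] : Measure (E (m + 1))).restrict F)), z ∈ Set.uIoc (0 : ℝ) 1 ×ˢ F := by
      have := ae_restrict_mem (μ := (volume : Measure ℝ).prod
        ((μHE[m] : Measure (E (m + 1))).restrict F))
        ((measurableSet_uIoc (a := (0 : ℝ)) (b := 1)).prod hFc.measurableSet)
      rwa [← Measure.prod_restrict, Measure.restrict_restrict hFc.measurableSet,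
        Set.inter_self] at this
    filter_upwards [h1] with z hz
    refine hC z ⟨?_, hz.2⟩
    have := hz.1
    rw [Set.uIoc_of_le zero_le_one] at this
    exact ⟨this.1.le, this.2⟩
  have hswap := intervalIntegral_integral_swap (μ := (μHE[m] : Measure (E (m + 1))).restrict F) hint
  calc _ = ∫ s in (0 : ℝ)..1, ∫ y in F, G s y ∂μHE[m] := by
        simp only [G, integral_const_mul]
    _ = ∫ y in F, (∫ s in (0 : ℝ)..1, G s y) ∂μHE[m] := hswap
    _ = _ := by
        congr 1
        funext y
        -- Along the ray from `a` to `y` the integrand is the derivative of `s ^ (m + 1) * p (a + s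
        -- • (y - a))`, which is 0 at `s = 0` and `p y` at `s = 1`.
        have hd : ∀ s ∈ Set.uIcc (0 : ℝ) 1,
            HasDerivAt (fun s : ℝ => s ^ (m + 1) * p (a + s • (y - a))) (G s y) s := by
          intro s _
          have h1 : HasDerivAt (fun s : ℝ => a + s • (y - a)) (y - a) s := by
            simpa using ((hasDerivAt_id s).smul_const (y - a)).const_add a
          have h2 := ((hp.differentiable one_ne_zero (a + s • (y - a))).hasFDerivAt).comp_hasDerivAt
            s h1
          have h3 := (hasDerivAt_pow (m + 1) s).mul h2
          refine h3.congr_deriv ?_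
          simp only [G, add_sub_cancel_left, map_smul, smul_eq_mul, Nat.add_sub_cancel,
            Function.comp_apply]
          push_cast
          ring
        rw [intervalIntegral.integral_eq_sub_of_hasDerivAt hd
          ((hG.comp (Continuous.prodMk_left y)).intervalIntegrable _ _)]
        simp

/-! ### Barycentric coordinates of a simplex -/

/-- The vertices of a nondegenerate simplex as an affine basis. -/
def vertexBasis {d : ℕ} {K : Finset (E d)} (hc : K.card = d + 1)
    (hi : AffineIndependent ℝ (fun p : K => (p : E d))) : AffineBasis K ℝ (E d) :=
  ⟨fun p => p, hi, hi.affineSpan_eq_top_iff_card_eq_finrank_add_one.mpr (by simp [hc])⟩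

section Simplex
variable {d : ℕ} {K : Finset (E d)} (hc : K.card = d + 1)
  (hi : AffineIndependent ℝ (fun p : K => (p : E d)))

/-- The barycentric coordinates of a simplex. -/
abbrev bary (i : K) (x : E d) : ℝ := (vertexBasis hc hi).coord i x

/-- The linear part of the barycentric coordinates. -/
abbrev baryLin (i : K) : E d →ₗ[ℝ] ℝ := ((vertexBasis hc hi).coord i).linear

@[simp] theorem vertexBasis_apply (i : K) : vertexBasis hc hi i = (i : E d) := rfl

theorem range_vertexBasis : Set.range (vertexBasis hc hi) = (K : Set (E d)) := by
  ext x; simp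

theorem bary_sub (i : K) (x y : E d) : bary hc hi i x - bary hc hi i y = baryLin hc hi i (x - y) :=
  ((vertexBasis hc hi).coord i).linearMap_vsub x y |>.symm

theorem bary_add (i : K) (x w : E d) : bary hc hi i (x + w) = bary hc hi i x + baryLin hc hi i w := by
  have := bary_sub hc hi i (x + w) x
  rw [add_sub_cancel_left] at this
  linarith

theorem bary_self (i : K) : bary hc hi i i = 1 := (vertexBasis hc hi).coord_apply_eq i

theorem bary_ne {i j : K} (h : i ≠ j) : bary hc hi i j = 0 := (vertexBasis hc hi).coord_apply_ne h

theorem continuous_bary (i : K) : Continuous (bary hc hi i) :=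
  continuous_barycentric_coord (vertexBasis hc hi) i

theorem sum_bary (x : E d) : ∑ i, bary hc hi i x = 1 := (vertexBasis hc hi).sum_coord_apply_eq_one x

theorem sum_bary_smul (x : E d) : ∑ i : K, bary hc hi i x • (i : E d) = x :=
  (vertexBasis hc hi).linear_combination_coord_eq_self x

theorem baryLin_eq (i : K) (w : E d) : baryLin hc hi i w = bary hc hi i w - bary hc hi i 0 := by
  rw [bary_sub, sub_zero]

theorem sum_baryLin (w : E d) : ∑ i, baryLin hc hi i w = 0 := by
  simp_rw [baryLin_eq, Finset.sum_sub_distrib, sum_bary, sub_self]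

/-- Together with `sum_baryLin` this decomposes a direction: `w` is the combination of the vectors
`i - p`, for any `p`, with weights `baryLin i w`. -/
theorem sum_baryLin_smul (w : E d) : ∑ i : K, baryLin hc hi i w • (i : E d) = w := by
  simp_rw [baryLin_eq, sub_smul, Finset.sum_sub_distrib, sum_bary_smul, sub_zero]

theorem mem_convexHull_simplex {x : E d} :
    x ∈ convexHull ℝ (K : Set (E d)) ↔ ∀ i, 0 ≤ bary hc hi i x := by
  rw [← range_vertexBasis hc hi, (vertexBasis hc hi).convexHull_eq_nonneg_coord]; rfl

theorem mem_interior_convexHull_simplex {x : E d} :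
    x ∈ interior (convexHull ℝ (K : Set (E d))) ↔ ∀ i, 0 < bary hc hi i x := by
  rw [← range_vertexBasis hc hi, (vertexBasis hc hi).interior_convexHull]; rfl

/-- The zero set of a barycentric coordinate is convex and contains every other vertex. -/
theorem bary_eq_zero_of_mem_convexHull {S : Set (E d)} (hS : S ⊆ K) {x : E d}
    (hx : x ∈ convexHull ℝ S) {i : K} (hiS : (i : E d) ∉ S) : bary hc hi i x = 0 := by
  have hconv : Convex ℝ {x | bary hc hi i x = 0} := by
    have : {x | bary hc hi i x = 0} = (vertexBasis hc hi).coord i ⁻¹' {0} := rfl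
    rw [this]
    exact (convex_singleton (0 : ℝ)).affine_preimage _
  refine convexHull_min (fun y hy => ?_) hconv hx
  exact bary_ne hc hi (i := i) (j := ⟨y, hS hy⟩) (fun h => hiS (by rw [h]; exact hy))

theorem mem_convexHull_face {S : Set (E d)} (hS : S ⊆ K) {x : E d} :
    x ∈ convexHull ℝ S ↔
      (∀ i, 0 ≤ bary hc hi i x) ∧ ∀ i : K, (i : E d) ∉ S → bary hc hi i x = 0 := by
  refine ⟨fun hx => ⟨(mem_convexHull_simplex hc hi).mp (convexHull_mono hS hx),
    fun i hiS => bary_eq_zero_of_mem_convexHull hc hi hS hx hiS⟩, fun ⟨h0, h1⟩ => ?_⟩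
  classical
  have hsum : ∑ i ∈ Finset.univ.filter (fun i : K => (i : E d) ∈ S), bary hc hi i x = 1 := by
    rw [← sum_bary hc hi x]
    refine Finset.sum_subset (Finset.filter_subset _ _) (fun i _ hin => h1 i ?_)
    simpa using hin
  have hx : ∑ i ∈ Finset.univ.filter (fun i : K => (i : E d) ∈ S), bary hc hi i x • (i : E d) = x := by
    conv_rhs => rw [← sum_bary_smul hc hi x]
    refine Finset.sum_subset (Finset.filter_subset _ _) (fun i _ hin => ?_)
    rw [h1 i (by simpa using hin), zero_smul]
  rw [← hx]
  exact (convex_convexHull ℝ S).sum_mem (fun i _ => h0 i) hsum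
    (fun i hiS => subset_convexHull ℝ S (Finset.mem_filter.mp hiS).2)

theorem isCompact_convexHull_finset (S : Finset (E d)) : IsCompact (convexHull ℝ (S : Set (E d))) :=
  S.finite_toSet.isCompact_convexHull ℝ

end Simplex

/-! ### Outward normals -/

section Normal
variable {m : ℕ} {K : Finset (E (m + 1))}

-- The barycentric coordinate of `a` is constant on the opposite facet and larger at `a`, so its
-- negative normalized gradient is the outward normal.
open Classical in
theorem exists_isOutwardNormal (hc : K.card = m + 1 + 1)
    (hi : AffineIndependent ℝ (fun p : K => (p : E (m + 1)))) (a : K) : ∃ ν, IsOutwardNormal K (K.erase a) ν := by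
  obtain ⟨g, hg⟩ : ∃ g : E (m + 1), ∀ w, inner ℝ g w = baryLin hc hi a w :=
    ⟨(InnerProductSpace.toDual ℝ (E (m + 1))).symm
      (LinearMap.toContinuousLinearMap (baryLin hc hi a)), fun w => by simp⟩
  have hF : ∀ p ∈ K.erase a, bary hc hi a p = 0 := fun p hp => by
    obtain ⟨h1, h2⟩ := Finset.mem_erase.mp hp
    exact bary_ne hc hi (j := ⟨p, h2⟩) (fun h => h1 (by rw [h]))
  obtain ⟨p₀, hp₀⟩ : (K.erase a).Nonempty := by
    rw [← Finset.card_pos, Finset.card_erase_of_mem a.2, hc]; omega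
  have hap : ∀ p ∈ K.erase a, inner ℝ g (a - p) = 1 := fun p hp => by
    rw [hg, ← bary_sub, hF p hp, bary_self, sub_zero]
  have hg0 : 0 < ‖g‖ := by
    rw [norm_pos_iff]; rintro rfl
    have := hap p₀ hp₀
    simp at this
  refine ⟨(-‖g‖⁻¹) • g, ?_, fun p hp q hq => ?_, fun r hr hrF p hp => ?_⟩
  · rw [norm_smul, norm_neg, norm_inv, norm_norm, inv_mul_cancel₀ hg0.ne']
  · rw [real_inner_smul_left, hg, ← bary_sub, hF q hq, hF p hp]; simp
  · have hra : r = a := by by_contra hne; exact hrF (Finset.mem_erase.mpr ⟨hne, hr⟩)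
    rw [hra, real_inner_smul_left, hap p hp]
    simpa using hg0

open Classical in
theorem isOutwardNormal_outwardNormal (hc : K.card = m + 1 + 1)
    (hi : AffineIndependent ℝ (fun p : K => (p : E (m + 1)))) (a : K) :
    IsOutwardNormal K (K.erase a) (outwardNormal K (K.erase a)) := by
  have h := exists_isOutwardNormal hc hi a
  rw [outwardNormal, dif_pos h]
  exact h.choose_spec

-- Both sides are linear in `w`, vanish along the facet and agree on `a - p`. The number `h` is the
-- height of the vertex `a` over the opposite facet.
open Classical in
theorem IsOutwardNormal.exists_inner_eq (hc : K.card = m + 1 + 1)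
    (hi : AffineIndependent ℝ (fun p : K => (p : E (m + 1)))) {a : K} {ν : E (m + 1)}
    (hν : IsOutwardNormal K (K.erase a) ν) :
    ∃ h : ℝ, 0 < h ∧ ∀ w, inner ℝ ν w = -h * baryLin hc hi a w := by
  obtain ⟨p, hp⟩ : (K.erase a).Nonempty := by
    rw [← Finset.card_pos, Finset.card_erase_of_mem a.2, hc]; omega
  refine ⟨-inner ℝ ν (a - p), neg_pos.mpr (hν.2.2 a a.2 (by simp) p hp), fun w => ?_⟩
  have hw : w = ∑ i : K, baryLin hc hi i w • ((i : E (m + 1)) - p) := by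
    simp_rw [smul_sub, Finset.sum_sub_distrib, ← Finset.sum_smul, sum_baryLin, zero_smul, sub_zero,
      sum_baryLin_smul]
  conv_lhs => rw [hw]
  rw [inner_sum, Finset.sum_eq_single a]
  · rw [inner_smul_right]; ring
  · intro i _ hia
    rw [inner_smul_right, hν.2.1 p hp i (Finset.mem_erase.mpr
      ⟨fun h => hia (Subtype.ext h), i.2⟩), mul_zero]
  · simp

end Normal

/-! ### The divergence theorem on a simplex -/

section Divergence
variable {m : ℕ} {K : Finset (E (m + 1))}

-- The simplex is a cone with apex `a` over the opposite facet: shrinking `a + w` towards `a` by the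
-- factor `s` multiplies the other barycentric coordinates by `s` and makes that of `a` equal to `1
-- - s`.
open Classical in
theorem setIntegral_radial_simplex (hc : K.card = m + 1 + 1)
    (hi : AffineIndependent ℝ (fun p : K => (p : E (m + 1)))) (a : K) {h : ℝ} (hh : 0 < h)
    (hν : ∀ w, inner ℝ (outwardNormal K (K.erase a)) w = -h * baryLin hc hi a w)
    (p : E (m + 1) → ℝ) (hp : ContDiff ℝ 1 p) :
    ∫ x in convexHull ℝ (K : Set (E (m + 1))), ((m + 1) * p x + fderiv ℝ p x (x - a)) =
      h * facetInt (K.erase a) p := by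
  have hsub : ((K.erase a : Finset (E (m + 1))) : Set (E (m + 1))) ⊆ K := by simp
  have hin : ∀ x, inner ℝ (outwardNormal K (K.erase a)) (x - a) = h * (1 - bary hc hi a x) := by
    intro x
    rw [hν, ← bary_sub, bary_self]; ring
  refine setIntegral_radial _ (isOutwardNormal_outwardNormal hc hi a).1 a hh
    (isCompact_convexHull_finset K) (isCompact_convexHull_finset (K.erase a)) (fun x hx => ?_)
    (fun x hx => ?_) (fun s hs hs1 w hw => ?_) p hp
  · have h0 := (mem_convexHull_simplex hc hi).mp hx
    have h1 : bary hc hi a x ≤ 1 := by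
      rw [← sum_bary hc hi x]
      exact Finset.single_le_sum (f := fun i => bary hc hi i x) (fun i _ => h0 i)
        (Finset.mem_univ a)
    have h2 := h0 a
    rw [hin]
    constructor <;> nlinarith
  · rw [hin, bary_eq_zero_of_mem_convexHull hc hi hsub hx (by simp)]; ring
  · have haw : bary hc hi a (a + w) = 0 := by
      have := hin (a + w)
      rw [add_sub_cancel_left, hw] at this
      have h3 : h * bary hc hi a (a + w) = 0 := by linarith
      exact (mul_eq_zero.mp h3).resolve_left hh.ne'
    rw [mem_convexHull_face hc hi hsub, mem_convexHull_simplex hc hi]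
    have hlin : ∀ i, baryLin hc hi i (s • w) = s * baryLin hc hi i w := fun i => by
      rw [map_smul, smul_eq_mul]
    constructor
    · intro hx
      refine ⟨fun i => ?_, fun i hiS => ?_⟩
      · by_cases hia : i = a
        · rw [hia, haw]
        · have h1 := hx i
          rw [bary_add, hlin, bary_ne hc hi hia, zero_add] at h1
          rw [bary_add, bary_ne hc hi hia, zero_add]
          exact nonneg_of_mul_nonneg_right h1 hs
      · have : i = a := by
          by_contra hne
          exact hiS (by simpa using fun h => hne (Subtype.ext h))
        rw [this, haw]
    · rintro ⟨hx, -⟩ i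
      by_cases hia : i = a
      · rw [hia, bary_add, hlin, bary_self]
        rw [bary_add, bary_self] at haw
        nlinarith
      · have h1 := hx i
        rw [bary_add, bary_ne hc hi hia, zero_add] at h1 ⊢
        rw [hlin]
        positivity

theorem interior_convexHull_ae_eq {d : ℕ} (K : Finset (E d)) :
    (interior (convexHull ℝ (K : Set (E d))) : Set (E d)) =ᵐ[volume] convexHull ℝ (K : Set (E d)) :=
  interior_ae_eq_of_null_frontier ((convex_convexHull ℝ _).addHaar_frontier _)

open Classical in
/-- The divergence theorem on a simplex, for a `C¹` function and a constant direction `w`. -/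
theorem setIntegral_fderiv_simplex (hc : K.card = m + 1 + 1)
    (hi : AffineIndependent ℝ (fun p : K => (p : E (m + 1)))) (p : E (m + 1) → ℝ) (hp : ContDiff ℝ 1 p) (w : E (m + 1)) :
    ∫ x in interior (convexHull ℝ (K : Set (E (m + 1)))), fderiv ℝ p x w =
      ∑ a : K, inner ℝ (outwardNormal K (K.erase a)) w * facetInt (K.erase a) p := by
  rw [setIntegral_congr_set (interior_convexHull_ae_eq K)]
  have hp' : Continuous (fun x => fderiv ℝ p x) := hp.continuous_fderiv one_ne_zero
  choose h hh hν using fun a : K => (isOutwardNormal_outwardNormal hc hi a).exists_inner_eq hc hi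
  have hR : ∀ a : K, inner ℝ (outwardNormal K (K.erase a)) w * facetInt (K.erase a) p =
      -- The height from `hν` cancels the factor `h` of `setIntegral_radial_simplex`. Summed over
      -- `a`, the fields `-baryLin a w • (x - a)` give the constant `w`, and the zeroth-order terms
      -- drop out because the weights sum to zero.
      ∫ x in convexHull ℝ (K : Set (E (m + 1))),
        -baryLin hc hi a w * ((m + 1) * p x + fderiv ℝ p x (x - a)) := by
    intro a
    rw [integral_const_mul, setIntegral_radial_simplex hc hi a (hh a) (hν a) p hp, hν]
    ring
  simp_rw [hR]
  rw [← integral_finsetSum]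
  · congr 1
    funext x
    have h1 : ∀ a : K, -baryLin hc hi a w * ((m + 1) * p x + fderiv ℝ p x (x - a)) =
        -((m + 1) * p x + fderiv ℝ p x x) * baryLin hc hi a w +
          fderiv ℝ p x (baryLin hc hi a w • (a : E (m + 1))) := by
      intro a
      rw [map_smul, map_sub, smul_eq_mul]; ring
    simp_rw [h1, Finset.sum_add_distrib, ← Finset.mul_sum, sum_baryLin, ← map_sum,
      sum_baryLin_smul]
    ring
  · intro a _
    refine Continuous.continuousOn ?_ |>.integrableOn_compact (isCompact_convexHull_finset K)
    exact continuous_const.mul ((continuous_const.mul hp.continuous).add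
      (hp'.clm_apply (continuous_id.sub continuous_const)))

end Divergence

/-! ### Geometry of conforming meshes -/

section Mesh
variable {d : ℕ} {Ω : Set (E d)}

theorem mem_facets {T : Triangulation d Ω} {F : Finset (E d)} :
    F ∈ facets T ↔ ∃ K : Cell T, F ⊆ K.1 ∧ F.card = d := by
  simp only [facets, Finset.mem_biUnion, Finset.mem_powersetCard, Subtype.exists, exists_prop]

theorem mem_adj {T : Triangulation d Ω} {F : Finset (E d)} {K : Cell T} :
    K ∈ adj T F ↔ F ⊆ K.1 := by
  simp [adj]

open Classical in
theorem exists_eq_erase {K F : Finset (E d)} (hFK : F ⊆ K) (hF : F.card = d) (hK : K.card = d + 1) :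
    ∃ a : K, F = K.erase a := by
  have h1 : (K \ F).card = 1 := by rw [Finset.card_sdiff_of_subset hFK]; omega
  obtain ⟨a, ha⟩ := Finset.card_eq_one.mp h1
  have haK : a ∈ K \ F := by rw [ha]; simp
  refine ⟨⟨a, (Finset.mem_sdiff.mp haK).1⟩, ?_⟩
  rw [Finset.erase_eq, ← ha, Finset.sdiff_sdiff_eq_self hFK]

/-- A face of a simplex has a point in its relative interior. -/
theorem exists_mem_convexHull_bary_pos {K F : Finset (E d)} (hc : K.card = d + 1)
    (hi : AffineIndependent ℝ (fun p : K => (p : E d))) (hFK : F ⊆ K) (hF : F.Nonempty) :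
    ∃ x ∈ convexHull ℝ (F : Set (E d)), ∀ i : K, (i : E d) ∈ F → 0 < bary hc hi i x := by
  classical
  set s : Finset K := Finset.univ.filter (fun i : K => (i : E d) ∈ F) with hs
  have hmem : ∀ i, i ∈ s ↔ (i : E d) ∈ F := fun i => by simp [hs]
  have hsn : 0 < s.card := by
    obtain ⟨p, hp⟩ := hF
    exact Finset.card_pos.mpr ⟨⟨p, hFK hp⟩, (hmem _).mpr hp⟩
  have hw : s.sum (fun _ => (s.card : ℝ)⁻¹) = 1 := by
    rw [Finset.sum_const, nsmul_eq_mul, mul_inv_cancel₀ (by positivity)]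
  -- The centroid of the face.
  set x := s.affineCombination ℝ (vertexBasis hc hi) (fun _ => (s.card : ℝ)⁻¹) with hx
  have h1 : ∀ i : K, (i : E d) ∈ F → bary hc hi i x = (s.card : ℝ)⁻¹ := fun i hiF =>
    (vertexBasis hc hi).coord_apply_combination_of_mem ((hmem i).mpr hiF) hw
  have h0 : ∀ i : K, (i : E d) ∉ F → bary hc hi i x = 0 := fun i hiF =>
    (vertexBasis hc hi).coord_apply_combination_of_notMem (fun h => hiF ((hmem i).mp h)) hw
  refine ⟨x, (mem_convexHull_face hc hi (by simpa using hFK)).mpr ⟨fun i => ?_, fun i hiF => h0 i hiF⟩,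
    fun i hiF => ?_⟩
  · by_cases hiF : (i : E d) ∈ F
    · rw [h1 i hiF]; positivity
    · rw [h0 i hiF]
  · rw [h1 i hiF]; positivity

theorem continuous_bary_line {K : Finset (E d)} (hc : K.card = d + 1)
    (hi : AffineIndependent ℝ (fun p : K => (p : E d))) (i : K) (x w : E d) :
    Continuous (fun s : ℝ => bary hc hi i (x + s • w)) :=
  (continuous_bary hc hi i).comp (by fun_prop)

theorem bary_line {K : Finset (E d)} (hc : K.card = d + 1)
    (hi : AffineIndependent ℝ (fun p : K => (p : E d))) (i : K) (x y : E d) (s : ℝ) :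
    bary hc hi i (x + s • (y - x)) = bary hc hi i x + s * (bary hc hi i y - bary hc hi i x) := by
  rw [bary_add, map_smul, smul_eq_mul, bary_sub]

/-- By conformity a common point lies in the hull of the common vertices, so its coordinates at the
other vertices of `K` vanish. This is how conformity enters the geometric arguments. -/
theorem mem_inter_of_mem_convexHull {T : Triangulation d Ω} {K L : Cell T} {x : E d}
    (hK : x ∈ convexHull ℝ (K.1 : Set (E d))) (hL : x ∈ convexHull ℝ (L.1 : Set (E d))) {i : K.1}
    (hx : bary (T.card_cell K.1 K.2) (T.indep K.1 K.2) i x ≠ 0) : (i : E d) ∈ L.1 := by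
  by_contra hiL
  refine hx (bary_eq_zero_of_mem_convexHull _ _ (S := (K.1 : Set (E d)) ∩ L.1)
    Set.inter_subset_left ?_ (fun h => hiL h.2))
  rw [← T.conforming K.1 K.2 L.1 L.2]
  exact ⟨hK, hL⟩

theorem disjoint_openCell (T : Triangulation d Ω) {K L : Cell T} (hKL : K ≠ L) :
    Disjoint (openCell T K) (openCell T L) := by
  rw [Set.disjoint_left]
  intro x hxK hxL
  have hsub : K.1 ⊆ L.1 := fun i hiK =>
    mem_inter_of_mem_convexHull (interior_subset hxK) (interior_subset hxL) (i := ⟨i, hiK⟩)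
      ((mem_interior_convexHull_simplex _ _).mp hxK ⟨i, hiK⟩).ne'
  exact hKL (Subtype.ext (Finset.eq_of_subset_of_card_le hsub
    (by rw [T.card_cell K.1 K.2, T.card_cell L.1 L.2])))

/-- The closed cells cover the closure and have null boundaries, so almost every point of `Ω` is in
an open cell. Conversely an open cell lies in the interior of the closure, which is `Ω` by `hΩ`. -/
theorem ae_eq_iUnion_openCell (T : Triangulation d Ω) (hΩ : interior (closure Ω) = Ω) :
    Ω =ᵐ[volume] ⋃ K : Cell T, openCell T K := by
  have h1 : closure Ω = ⋃ K : Cell T, convexHull ℝ (K.1 : Set (E d)) := by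
    rw [← T.cover]; ext x; simp
  have h2 : (⋃ K : Cell T, openCell T K) =ᵐ[volume] closure Ω := by
    rw [h1]
    exact Filter.EventuallyEq.countable_iUnion (fun K => interior_convexHull_ae_eq K.1)
  have h3 : (⋃ K : Cell T, openCell T K) ⊆ Ω := by
    refine Set.Subset.trans ?_ hΩ.le
    rw [h1]
    refine Set.iUnion_subset (fun K => interior_mono ?_)
    exact Set.subset_iUnion (fun K : Cell T => convexHull ℝ (K.1 : Set (E d))) K
  refine Filter.EventuallyLE.antisymm ?_ h3.eventuallyLE
  exact (subset_closure.eventuallyLE).trans h2.symm.le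

theorem isCompact_closure_domain (T : Triangulation d Ω) : IsCompact (closure Ω) := by
  rw [← T.cover]
  exact T.cells.isCompact_biUnion (fun K _ => isCompact_convexHull_finset K)

theorem volInt_eq_setIntegral (T : Triangulation d Ω) (hΩ : interior (closure Ω) = Ω) (f : E d → ℝ)
    (hf : IntegrableOn f Ω) : volInt T (fun _ x => f x) = ∫ x in Ω, f x := by
  rw [volInt, setIntegral_congr_set (ae_eq_iUnion_openCell T hΩ), integral_iUnion_fintype]
  · exact fun K => isOpen_interior.measurableSet
  · exact fun K L hKL => disjoint_openCell T hKL
  · intro K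
    have h := hf.congr_set_ae (ae_eq_iUnion_openCell T hΩ).symm
    exact h.mono_set (Set.subset_iUnion (openCell T) K)

end Mesh

/-! ### Interfaces, opposite normals and boundary facets -/

section Facet
variable {m : ℕ} {Ω : Set (E (m + 1))}

theorem isOutwardNormal_of_mem_adj {T : Triangulation (m + 1) Ω} {F : Finset (E (m + 1))}
    (hF : F.card = m + 1) {K : Cell T} (hK : K ∈ adj T F) :
    IsOutwardNormal K.1 F (outwardNormal K.1 F) := by
  obtain ⟨a, rfl⟩ := exists_eq_erase (mem_adj.mp hK) hF (T.card_cell K.1 K.2)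
  exact isOutwardNormal_outwardNormal (T.card_cell K.1 K.2) (T.indep K.1 K.2) a

/-- The outward normals of the two sides of an interface are opposite. -/
theorem outwardNormal_eq_neg {T : Triangulation (m + 1) Ω} {F : Finset (E (m + 1))}
    (hF : F.card = m + 1) {K L : Cell T} (hK : K ∈ adj T F) (hL : L ∈ adj T F) (hKL : K ≠ L) :
    outwardNormal L.1 F = -outwardNormal K.1 F := by
  classical
  have hFn : F.Nonempty := Finset.card_pos.mp (by omega)
  have hνK := isOutwardNormal_of_mem_adj hF hK
  have hνL := isOutwardNormal_of_mem_adj hF hL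
  obtain ⟨a, ha⟩ := exists_eq_erase (mem_adj.mp hK) hF (T.card_cell K.1 K.2)
  obtain ⟨b, hb⟩ := exists_eq_erase (mem_adj.mp hL) hF (T.card_cell L.1 L.2)
  have hνK' := hνK
  have hνL' := hνL
  rw [ha] at hνK'
  rw [hb] at hνL'
  obtain ⟨hk, hk0, hkw⟩ := hνK'.exists_inner_eq (T.card_cell K.1 K.2) (T.indep K.1 K.2)
  obtain ⟨hl, hl0, hlw⟩ := hνL'.exists_inner_eq (T.card_cell L.1 L.2) (T.indep L.1 L.2)
  rw [← ha] at hkw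
  rw [← hb] at hlw
  have hmemF : ∀ i : L.1, i ≠ b → (i : E (m + 1)) ∈ F := fun i hib => by
    rw [hb]; exact Finset.mem_erase.mpr ⟨fun h => hib (Subtype.ext h), i.2⟩
  have haF : (a : E (m + 1)) ∉ F := by rw [ha]; simp
  have hbF : (b : E (m + 1)) ∉ F := by rw [hb]; simp
  have haL : (a : E (m + 1)) ∉ L.1 := fun h => hKL <| Subtype.ext <|
    Finset.eq_of_subset_of_card_le (fun i hiK => by
      by_cases hia : i = a
      · rw [hia]; exact h
      · exact mem_adj.mp hL (by rw [ha]; exact Finset.mem_erase.mpr ⟨hia, hiK⟩))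
      (by rw [T.card_cell K.1 K.2, T.card_cell L.1 L.2])
  set t := bary (T.card_cell L.1 L.2) (T.indep L.1 L.2) b a with ht
  -- the vertex of `K` opposite to `F` is not on the same side as that of `L`
  have htneg : t ≤ 0 := by
    by_contra! htpos
    obtain ⟨x, hxF, hxpos⟩ := exists_mem_convexHull_bary_pos (T.card_cell L.1 L.2)
      (T.indep L.1 L.2) (mem_adj.mp hL) hFn
    have hxb : bary (T.card_cell L.1 L.2) (T.indep L.1 L.2) b x = 0 :=
      bary_eq_zero_of_mem_convexHull _ _ (by simpa using mem_adj.mp hL) hxF (by simpa using hbF)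
    have hxa : bary (T.card_cell K.1 K.2) (T.indep K.1 K.2) a x = 0 :=
      bary_eq_zero_of_mem_convexHull _ _ (by simpa using mem_adj.mp hK) hxF (by simpa using haF)
    -- Moving from a relative interior point of `F` towards `a`, the `L`-coordinates at vertices of
    -- `F` stay positive for small `s`, and the one at `b` equals `s * t > 0`. The point is then in
    -- both cells with nonzero coordinate at `a`, so `a` would be a vertex of `L`.
    have hev : ∀ᶠ s : ℝ in 𝓝[>] 0, ∀ i,
        0 ≤ bary (T.card_cell L.1 L.2) (T.indep L.1 L.2) i (x + s • ((a : E (m + 1)) - x)) := by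
      rw [Filter.eventually_all]
      intro i
      by_cases hib : i = b
      · filter_upwards [self_mem_nhdsWithin] with s hs
        rw [hib, bary_line, hxb, ← ht, zero_add, sub_zero]
        exact mul_nonneg (le_of_lt hs) htpos.le
      · have h1 := (continuous_bary_line (T.card_cell L.1 L.2) (T.indep L.1 L.2) i x
          ((a : E (m + 1)) - x)).tendsto 0
        rw [zero_smul, add_zero] at h1
        exact ((h1.eventually (lt_mem_nhds (hxpos i (hmemF i hib)))).filter_mono
          nhdsWithin_le_nhds).mono (fun s hs => hs.le)
    obtain ⟨s, hs, hs0, hs1⟩ := (hev.and (Ioo_mem_nhdsGT (zero_lt_one (α := ℝ)))).exists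
    have hyL := (mem_convexHull_simplex (T.card_cell L.1 L.2) (T.indep L.1 L.2)).mpr hs
    have hyK : x + s • ((a : E (m + 1)) - x) ∈ convexHull ℝ (K.1 : Set (E (m + 1))) := by
      refine (convex_convexHull ℝ _).add_smul_sub_mem
        (convexHull_mono (by simpa using mem_adj.mp hK) hxF)
        (subset_convexHull ℝ _ (by simp)) ⟨hs0.le, hs1.le⟩
    refine haL (mem_inter_of_mem_convexHull hyK hyL ?_)
    rw [bary_line, hxa, bary_self]
    simpa using hs0.ne'
  obtain ⟨p, hp⟩ := hFn
  have hpb : bary (T.card_cell L.1 L.2) (T.indep L.1 L.2) b p = 0 :=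
    bary_eq_zero_of_mem_convexHull _ _ (S := (F : Set (E (m + 1)))) (by simpa using mem_adj.mp hL)
      (subset_convexHull ℝ _ (by simpa using hp)) (by simpa using hbF)
  have hap : inner ℝ (outwardNormal L.1 F) ((a : E (m + 1)) - p) = -hl * t := by
    rw [hlw, ← bary_sub, hpb, sub_zero]
  -- Both normals annihilate the directions of `F`, so they are proportional and the factor is read
  -- off at `a - p`. Unit length and `t ≤ 0` force it to be -1.
  have hprop : outwardNormal L.1 F = (hl * t / hk) • outwardNormal K.1 F := by
    refine ext_inner_right ℝ (fun w => ?_)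
    have hw : w = ∑ i : K.1, baryLin (T.card_cell K.1 K.2) (T.indep K.1 K.2) i w •
        ((i : E (m + 1)) - p) := by
      simp_rw [smul_sub, Finset.sum_sub_distrib, ← Finset.sum_smul, sum_baryLin, zero_smul,
        sub_zero, sum_baryLin_smul]
    conv_lhs => rw [hw]
    rw [inner_sum, Finset.sum_eq_single a, inner_smul_right, hap, real_inner_smul_left, hkw]
    · field_simp
    · intro i _ hia
      rw [inner_smul_right, hνL.2.1 p hp i, mul_zero]
      rw [ha]; exact Finset.mem_erase.mpr ⟨fun h => hia (Subtype.ext h), i.2⟩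
    · simp
  have hr : |hl * t / hk| = 1 := by
    have := congrArg norm hprop
    rw [norm_smul, hνK.1, hνL.1, Real.norm_eq_abs, mul_one] at this
    exact this.symm
  have hr0 : hl * t / hk ≤ 0 := div_nonpos_of_nonpos_of_nonneg
    (mul_nonpos_of_nonneg_of_nonpos hl0.le htneg) hk0.le
  rw [abs_of_nonpos hr0] at hr
  rw [hprop, show hl * t / hk = -1 by linarith, neg_one_smul]

/-- Three cells on one facet would have pairwise opposite unit normals. -/
theorem card_adj_le_two {T : Triangulation (m + 1) Ω} {F : Finset (E (m + 1))}
    (hF : F.card = m + 1) : (adj T F).card ≤ 2 := by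
  by_contra! h
  obtain ⟨K, hK, L, hL, M, hM, hKL, hKM, hLM⟩ := Finset.two_lt_card.mp h
  have h1 := outwardNormal_eq_neg hF hK hL hKL
  have h2 := outwardNormal_eq_neg hF hK hM hKM
  have h3 := outwardNormal_eq_neg hF hL hM hLM
  rw [h2, h1, neg_neg] at h3
  have h0 := (isOutwardNormal_of_mem_adj hF hK).1
  have h4 : (2 : ℝ) • outwardNormal K.1 F = 0 := by
    rw [two_smul]; nth_rewrite 1 [← h3]; simp
  rw [(smul_eq_zero.mp h4).resolve_left two_ne_zero] at h0
  simp at h0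

/-- A facet that belongs to a single cell lies on the boundary of the domain. -/
theorem convexHull_subset_frontier {T : Triangulation (m + 1) Ω} {F : Finset (E (m + 1))} (hF : F.card = m + 1) {K : Cell T} (hK : K ∈ adj T F)
    (huniq : ∀ L ∈ adj T F, L = K) : convexHull ℝ (F : Set (E (m + 1))) ⊆ frontier Ω := by
  classical
  have hFn : F.Nonempty := Finset.card_pos.mp (by omega)
  obtain ⟨a, ha⟩ := exists_eq_erase (mem_adj.mp hK) hF (T.card_cell K.1 K.2)
  have haF : (a : E (m + 1)) ∉ F := by rw [ha]; simp
  have hcover : closure Ω = ⋃ L : Cell T, convexHull ℝ (L.1 : Set (E (m + 1))) := by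
    rw [← T.cover]; ext x; simp
  have hFK : (F : Set (E (m + 1))) ⊆ K.1 := by simpa using mem_adj.mp hK
  have hcl : convexHull ℝ (F : Set (E (m + 1))) ⊆ closure Ω := by
    rw [hcover]
    exact (convexHull_mono hFK).trans
      (Set.subset_iUnion (fun K : Cell T => convexHull ℝ (K.1 : Set (E (m + 1)))) K)
  -- Crossing `F` away from `a` leaves `K`, and the other closed cells do not contain a relative
  -- interior point `x` of `F`, hence miss a neighbourhood of it. So points outside `closure Ω`
  -- accumulate at `x`. The rest of the facet follows since the frontier is closed.
  have hrel : ∀ x ∈ convexHull ℝ (F : Set (E (m + 1))),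
      (∀ i : K.1, (i : E (m + 1)) ∈ F →
        0 < bary (T.card_cell K.1 K.2) (T.indep K.1 K.2) i x) → x ∈ frontier Ω := by
    intro x hx hpos
    refine ⟨hcl hx, fun hxi => ?_⟩
    have hxa : bary (T.card_cell K.1 K.2) (T.indep K.1 K.2) a x = 0 :=
      bary_eq_zero_of_mem_convexHull _ _ hFK hx (by simpa using haF)
    have hlim : Filter.Tendsto (fun s : ℝ => x + s • ((a : E (m + 1)) - x)) (𝓝[<] 0) (𝓝 x) := by
      have : Continuous (fun s : ℝ => x + s • ((a : E (m + 1)) - x)) := by fun_prop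
      have h := this.tendsto 0
      rw [zero_smul, add_zero] at h
      exact h.mono_left nhdsWithin_le_nhds
    have hin : ∀ᶠ s : ℝ in 𝓝[<] 0, x + s • ((a : E (m + 1)) - x) ∈ closure Ω :=
      (hlim.eventually (isOpen_interior.mem_nhds hxi)).mono
        (fun s hs => subset_closure (interior_subset hs))
    have hout : ∀ᶠ s : ℝ in 𝓝[<] 0, ∀ L : Cell T,
        x + s • ((a : E (m + 1)) - x) ∉ convexHull ℝ (L.1 : Set (E (m + 1))) := by
      rw [Filter.eventually_all]
      intro L
      by_cases hLK : L = K
      · subst hLK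
        filter_upwards [self_mem_nhdsWithin] with s hs hmem
        have h1 := (mem_convexHull_simplex (T.card_cell L.1 L.2) (T.indep L.1 L.2)).mp hmem a
        rw [bary_line, hxa, bary_self] at h1
        have : s < 0 := hs
        linarith
      · have hxL : x ∉ convexHull ℝ (L.1 : Set (E (m + 1))) := fun hxL => hLK <| huniq L <|
          mem_adj.mpr fun i hiF => mem_inter_of_mem_convexHull (i := ⟨i, hFK hiF⟩)
            (convexHull_mono hFK hx) hxL (hpos ⟨i, hFK hiF⟩ hiF).ne'
        exact hlim.eventually ((isCompact_convexHull_finset L.1).isClosed.isOpen_compl.mem_nhds hxL)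
    obtain ⟨s, hs1, hs2⟩ := (hin.and hout).exists
    rw [hcover, Set.mem_iUnion] at hs1
    obtain ⟨L, hL⟩ := hs1
    exact hs2 L hL
  obtain ⟨x, hxF, hxpos⟩ := exists_mem_convexHull_bary_pos (T.card_cell K.1 K.2)
    (T.indep K.1 K.2) (mem_adj.mp hK) hFn
  intro y hy
  have hlim : Filter.Tendsto (fun s : ℝ => y + s • (x - y)) (𝓝[>] 0) (𝓝 y) := by
    have : Continuous (fun s : ℝ => y + s • (x - y)) := by fun_prop
    have h := this.tendsto 0
    rw [zero_smul, add_zero] at h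
    exact h.mono_left nhdsWithin_le_nhds
  refine isClosed_frontier.mem_of_tendsto hlim ?_
  filter_upwards [Ioo_mem_nhdsGT (zero_lt_one (α := ℝ))] with s hs
  refine hrel _ ((convex_convexHull ℝ _).add_smul_sub_mem hy hxF ⟨hs.1.le, hs.2.le⟩)
    (fun i hiF => ?_)
  rw [bary_line]
  have h1 := (mem_convexHull_simplex (T.card_cell K.1 K.2) (T.indep K.1 K.2)).mp
    (convexHull_mono hFK hy) i
  have h2 := hxpos i hiF
  obtain ⟨h3, h4⟩ := hs
  nlinarith

/-- This lets sums over all facets reduce to interfaces once the boundary traces vanish. -/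
theorem mem_boundaryFacets_of_notMem_interfaces {T : Triangulation (m + 1) Ω}
    {F : Finset (E (m + 1))} (hF : F ∈ facets T)
    (hFi : F ∉ interfaces T) : F ∈ boundaryFacets T := by
  classical
  obtain ⟨K, hFK, hcard⟩ := mem_facets.mp hF
  have hK : K ∈ adj T F := mem_adj.mpr hFK
  have h2 := card_adj_le_two (T := T) hcard
  have hne : (adj T F).card ≠ 2 := fun h => hFi (by simp [interfaces, hF, h])
  have h1 : (adj T F).card ≤ 1 := by omega
  simp only [boundaryFacets, Finset.mem_filter]
  exact ⟨hF, convexHull_subset_frontier hcard hK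
    (fun L hL => Finset.card_le_one.mp h1 L hL K hK)⟩

end Facet

/-! ### Polynomials as functions on Euclidean space -/

section Polynomial
variable {d : ℕ}

theorem contDiff_eval (p : MvPolynomial (Fin d) ℝ) :
    ContDiff ℝ 1 (fun x : E d => MvPolynomial.eval (fun i => x i) p) := by
  induction p using MvPolynomial.induction_on with
  | C a => simpa using contDiff_const
  | add p q hp hq => simpa using hp.add hq
  | mul_X p i hp =>
    simp only [map_mul, MvPolynomial.eval_X]
    exact hp.mul ((EuclideanSpace.proj i : E d →L[ℝ] ℝ).contDiff)

theorem fderiv_eval (p : MvPolynomial (Fin d) ℝ) (x : E d) (i : Fin d) :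
    fderiv ℝ (fun x : E d => MvPolynomial.eval (fun i => x i) p) x (EuclideanSpace.single i 1) =
      MvPolynomial.eval (fun i => x i) (MvPolynomial.pderiv i p) := by
  have hdiff := fun p : MvPolynomial (Fin d) ℝ => (contDiff_eval p).differentiable one_ne_zero x
  induction p using MvPolynomial.induction_on with
  | C a => simp
  | add p q hp hq =>
    simp only [map_add]
    rw [fderiv_fun_add (hdiff p) (hdiff q), ← hp, ← hq]; rfl
  | mul_X p j hp =>
    have hX : HasFDerivAt (fun x : E d => x j) (EuclideanSpace.proj j : E d →L[ℝ] ℝ) x :=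
      (EuclideanSpace.proj j : E d →L[ℝ] ℝ).hasFDerivAt
    have h := (hdiff p).hasFDerivAt.mul hX
    simp only [map_mul, MvPolynomial.eval_X]
    have h' : fderiv ℝ (fun x : E d => MvPolynomial.eval (fun i => x i) p * x j) x = _ := h.fderiv
    rw [h', Derivation.leibniz, MvPolynomial.pderiv_X]
    simp only [add_apply, smul_apply, hp, smul_eq_mul,
      map_add, map_mul, MvPolynomial.eval_X]
    by_cases hij : j = i
    · subst hij; simp
    · simp [hij]

end Polynomial

/-! ### Calculus of broken polynomials -/

section Broken
variable {d : ℕ} {Ω : Set (E d)} {T : Triangulation d Ω}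

@[simp] theorem ev_add (p q : BPoly T) (K : Cell T) (x : E d) :
    ev (p + q) K x = ev p K x + ev q K x := by simp [ev]

@[simp] theorem ev_sub (p q : BPoly T) (K : Cell T) (x : E d) :
    ev (p - q) K x = ev p K x - ev q K x := by simp [ev]

@[simp] theorem ev_mul (p q : BPoly T) (K : Cell T) (x : E d) :
    ev (p * q) K x = ev p K x * ev q K x := by simp [ev]

@[simp] theorem ev_one (K : Cell T) (x : E d) : ev (1 : BPoly T) K x = 1 := by simp [ev]

@[simp] theorem ev_smul (c : ℝ) (p : BPoly T) (K : Cell T) (x : E d) :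
    ev (c • p) K x = c * ev p K x := by simp [ev]

@[simp] theorem ev_sum {ι : Type*} (s : Finset ι) (p : ι → BPoly T) (K : Cell T) (x : E d) :
    ev (∑ i ∈ s, p i) K x = ∑ i ∈ s, ev (p i) K x := by simp [ev]

@[simp] theorem D_mul (i : Fin d) (p q : BPoly T) : D i (p * q) = D i p * q + p * D i q := by
  funext K; simp [D, Derivation.leibniz]; ring

@[simp] theorem D_sub (i : Fin d) (p q : BPoly T) : D i (p - q) = D i p - D i q := by
  funext K; simp [D]

@[simp] theorem D_sum {ι : Type*} (i : Fin d) (s : Finset ι) (p : ι → BPoly T) :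
    D i (∑ j ∈ s, p j) = ∑ j ∈ s, D i (p j) := by
  funext K; simp [D]

@[simp] theorem ev_divg (u : Fin d → BPoly T) (K : Cell T) (x : E d) :
    ev (divg u) K x = ∑ i, ev (D i (u i)) K x := by simp [divg]

@[fun_prop] theorem continuous_ev (p : BPoly T) (K : Cell T) : Continuous (ev p K) :=
  (contDiff_eval (p K)).continuous

theorem ev_divg_mul (p : BPoly T) (u : Fin d → BPoly T) (K : Cell T) (x : E d) :
    ev (divg fun i => p * u i) K x =
      ∑ i, ev (D i p) K x * ev (u i) K x + ev p K x * ev (divg u) K x := by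
  simp [Finset.sum_add_distrib, Finset.mul_sum]

@[fun_prop] theorem continuous_avg {M : Type} [AddCommGroup M] [Module ℝ M] [TopologicalSpace M]
    [ContinuousAdd M] [ContinuousConstSMul ℝ M] (F : Finset (E d)) (g : Cell T → E d → M)
    (hg : ∀ K, Continuous (g K)) : Continuous (avg T F g) :=
  (continuous_finsetSum _ fun K _ => hg K).const_smul _

theorem continuous_evVec (u : Fin d → BPoly T) (K : Cell T) : Continuous (evVec u K) :=
  continuous_pi fun i => continuous_ev (u i) K

theorem continuous_jump (F : Finset (E d)) (p : BPoly T) : Continuous (jump T F (ev p)) :=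
  continuous_pi fun _ => continuous_finsetSum _ fun K _ => (continuous_ev p K).mul continuous_const

theorem continuous_jumpVec (F : Finset (E d)) (u : Fin d → BPoly T) :
    Continuous (jumpVec T F (evVec u)) :=
  continuous_finsetSum _ fun K _ => continuous_finsetSum _ fun i _ =>
    (continuous_ev (u i) K).mul continuous_const

theorem continuous_jump_dotProduct_avg (F : Finset (E d)) (p : BPoly T) (u : Fin d → BPoly T) :
    Continuous (fun x => jump T F (ev p) x ⬝ᵥ avg T F (evVec u) x) :=
  (continuous_jump F p).dotProduct (continuous_avg F _ (continuous_evVec u))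

theorem continuous_jumpVec_mul_avg (F : Finset (E d)) (u : Fin d → BPoly T) (p : BPoly T) :
    Continuous (fun x => jumpVec T F (evVec u) x * avg T F (ev p) x) :=
  (continuous_jumpVec F u).mul (continuous_avg F _ (continuous_ev p))

/-! ### Linearity of the integrals -/

theorem integrableOn_openCell_of_continuous (K : Cell T) {g : E d → ℝ} (hg : Continuous g) :
    IntegrableOn g (openCell T K) :=
  (hg.continuousOn.integrableOn_compact (isCompact_convexHull_finset K.1)).mono_set interior_subset

/-- The continuous factor is bounded on the closed simplex, which differs from the open cell by a
null set. It serves for `1/ρ` and the difference quotients, which are only known to be integrable.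
-/
theorem integrableOn_openCell_mul_continuous {K : Cell T} {f g : E d → ℝ}
    (hf : IntegrableOn f (openCell T K)) (hg : Continuous g) :
    IntegrableOn (fun x => f x * g x) (openCell T K) := by
  have h := hf.congr_set_ae (interior_convexHull_ae_eq K.1).symm
  exact (h.mul_continuousOn hg.continuousOn (isCompact_convexHull_finset K.1)).mono_set
    interior_subset

theorem integrableOn_openCell_of_memLp {K : Cell T} {f : E d → ℝ}
    (hf : MemLp f 2 (volume.restrict (openCell T K))) : IntegrableOn f (openCell T K) := by
  have : IsFiniteMeasure (volume.restrict (openCell T K)) := ⟨by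
    rw [Measure.restrict_apply_univ]
    exact (measure_mono interior_subset).trans_lt (isCompact_convexHull_finset K.1).measure_lt_top⟩
  exact hf.integrable one_le_two

theorem volInt_add {f g : Cell T → E d → ℝ} (hf : ∀ K, IntegrableOn (f K) (openCell T K))
    (hg : ∀ K, IntegrableOn (g K) (openCell T K)) :
    volInt T (fun K x => f K x + g K x) = volInt T f + volInt T g := by
  simp only [volInt, ← Finset.sum_add_distrib]
  exact Finset.sum_congr rfl fun K _ => integral_add (hf K) (hg K)

theorem volInt_sub {f g : Cell T → E d → ℝ} (hf : ∀ K, IntegrableOn (f K) (openCell T K))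
    (hg : ∀ K, IntegrableOn (g K) (openCell T K)) :
    volInt T (fun K x => f K x - g K x) = volInt T f - volInt T g := by
  simp only [volInt, ← Finset.sum_sub_distrib]
  exact Finset.sum_congr rfl fun K _ => integral_sub (hf K) (hg K)

theorem volInt_const_mul (c : ℝ) (f : Cell T → E d → ℝ) :
    volInt T (fun K x => c * f K x) = c * volInt T f := by
  simp only [volInt, Finset.mul_sum, integral_const_mul]

/-- A broken function that is integrable on all mesh elements, with given integral. -/
def HasVolInt (f : Cell T → E d → ℝ) (a : ℝ) : Prop :=
  (∀ K, IntegrableOn (f K) (openCell T K)) ∧ volInt T f = a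

theorem hasVolInt_volInt {f : Cell T → E d → ℝ} (hf : ∀ K, IntegrableOn (f K) (openCell T K)) :
    HasVolInt f (volInt T f) := ⟨hf, rfl⟩

theorem HasVolInt.add {f g : Cell T → E d → ℝ} {a b : ℝ} (hf : HasVolInt f a)
    (hg : HasVolInt g b) : HasVolInt (fun K x => f K x + g K x) (a + b) :=
  ⟨fun K => (hf.1 K).add (hg.1 K), by rw [volInt_add hf.1 hg.1, hf.2, hg.2]⟩

theorem HasVolInt.sub {f g : Cell T → E d → ℝ} {a b : ℝ} (hf : HasVolInt f a)
    (hg : HasVolInt g b) : HasVolInt (fun K x => f K x - g K x) (a - b) :=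
  ⟨fun K => (hf.1 K).sub (hg.1 K), by rw [volInt_sub hf.1 hg.1, hf.2, hg.2]⟩

theorem HasVolInt.const_mul (c : ℝ) {f : Cell T → E d → ℝ} {a : ℝ} (hf : HasVolInt f a) :
    HasVolInt (fun K x => c * f K x) (c * a) :=
  ⟨fun K => (hf.1 K).const_mul c, by rw [volInt_const_mul, hf.2]⟩

end Broken

/-! ### Facet integrals and elementwise integration by parts -/

section Interface
variable {d : ℕ} {Ω : Set (E d)} {T : Triangulation d Ω}

theorem integrableOn_facet (hd : 0 < d) {F : Finset (E d)} (hF : F ∈ facets T) {g : E d → ℝ}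
    (hg : Continuous g) : IntegrableOn g (convexHull ℝ (F : Set (E d))) μHE[d - 1] := by
  obtain ⟨m, rfl⟩ : ∃ m, d = m + 1 := ⟨d - 1, by omega⟩
  obtain ⟨K, hFK, hcard⟩ := mem_facets.mp hF
  have hν := isOutwardNormal_of_mem_adj hcard (mem_adj.mpr hFK)
  obtain ⟨p, hp⟩ : F.Nonempty := Finset.card_pos.mp (by omega)
  have hflat : ∀ x ∈ convexHull ℝ (F : Set (E (m + 1))),
      inner ℝ (outwardNormal K.1 F) (x - p) = 0 := by
    have hconv : Convex ℝ {x : E (m + 1) | inner ℝ (outwardNormal K.1 F) (x - p) = 0} := by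
      intro x hx y hy a b _ _ hab
      have h : a • x + b • y - p = a • (x - p) + b • (y - p) := by
        rw [smul_sub, smul_sub, sub_add_sub_comm, ← add_smul, hab, one_smul]
      simp only [Set.mem_ofPred_eq] at hx hy ⊢
      rw [h, inner_add_right, inner_smul_right, inner_smul_right, hx, hy]; ring
    exact fun x hx => convexHull_min (fun q hq => hν.2.1 p hp q (by simpa using hq)) hconv hx
  have hlt : (μHE[m] : Measure (E (m + 1))) (convexHull ℝ (F : Set (E (m + 1)))) < ⊤ :=
    euclideanHausdorff_lt_top_of_isCompact _ hν.1 p hflat (isCompact_convexHull_finset F)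
  obtain ⟨C, hC⟩ := (isCompact_convexHull_finset F).exists_bound_of_continuousOn hg.continuousOn
  exact Measure.integrableOn_of_bounded hlt.ne hg.aestronglyMeasurable
    (ae_restrict_of_forall_mem (isCompact_convexHull_finset F).measurableSet hC)

theorem mem_facets_of_mem_interfaces {F : Finset (E d)} (hF : F ∈ interfaces T) : F ∈ facets T := by
  classical
  simp only [interfaces, Finset.mem_filter] at hF
  exact hF.1

theorem card_adj_of_mem_interfaces {F : Finset (E d)} (hF : F ∈ interfaces T) :
    (adj T F).card = 2 := by
  classical
  simp only [interfaces, Finset.mem_filter] at hF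
  exact hF.2

theorem interfaceInt_congr {f g : Finset (E d) → E d → ℝ} (h : ∀ F ∈ interfaces T, ∀ x, f F x = g F x) :
    interfaceInt T f = interfaceInt T g :=
  Finset.sum_congr rfl fun F hF => by rw [funext (h F hF)]

theorem interfaceInt_add (hd : 0 < d) {f g : Finset (E d) → E d → ℝ} (hf : ∀ F, Continuous (f F))
    (hg : ∀ F, Continuous (g F)) :
    interfaceInt T (fun F x => f F x + g F x) = interfaceInt T f + interfaceInt T g := by
  simp only [interfaceInt, ← Finset.sum_add_distrib]
  exact Finset.sum_congr rfl fun F hF =>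
    integral_add (integrableOn_facet hd (mem_facets_of_mem_interfaces hF) (hf F))
      (integrableOn_facet hd (mem_facets_of_mem_interfaces hF) (hg F))

theorem interfaceInt_sub (hd : 0 < d) {f g : Finset (E d) → E d → ℝ} (hf : ∀ F, Continuous (f F))
    (hg : ∀ F, Continuous (g F)) :
    interfaceInt T (fun F x => f F x - g F x) = interfaceInt T f - interfaceInt T g := by
  simp only [interfaceInt, ← Finset.sum_sub_distrib]
  exact Finset.sum_congr rfl fun F hF =>
    integral_sub (integrableOn_facet hd (mem_facets_of_mem_interfaces hF) (hf F))
      (integrableOn_facet hd (mem_facets_of_mem_interfaces hF) (hg F))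

theorem interfaceInt_const_mul (c : ℝ) (f : Finset (E d) → E d → ℝ) :
    interfaceInt T (fun F x => c * f F x) = c * interfaceInt T f := by
  simp only [interfaceInt, facetInt, Finset.mul_sum, integral_const_mul]

/-- The divergence theorem on a mesh element, for polynomials. -/
theorem setIntegral_D (hd : 0 < d) (p : BPoly T) (K : Cell T) (i : Fin d) :
    ∫ x in openCell T K, ev (D i p) K x =
      ∑ F ∈ K.1.powersetCard d, outwardNormal K.1 F i * facetInt F (ev p K) := by
  classical
  obtain ⟨m, rfl⟩ : ∃ m, d = m + 1 := ⟨d - 1, by omega⟩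
  have h := setIntegral_fderiv_simplex (T.card_cell K.1 K.2) (T.indep K.1 K.2) (ev p K)
    (contDiff_eval (p K)) (EuclideanSpace.single i 1)
  have h1 : ∀ x, fderiv ℝ (ev p K) x (EuclideanSpace.single i 1) = ev (D i p) K x :=
    fun x => fderiv_eval (p K) x i
  simp_rw [h1] at h
  rw [openCell, h]
  have h2 : ∀ ν : E (m + 1), inner ℝ ν (EuclideanSpace.single i (1 : ℝ)) = ν i := fun ν => by
    rw [EuclideanSpace.inner_single_right]; simp
  simp_rw [h2]
  -- Facets of a cell correspond to the vertex they omit.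
  refine Finset.sum_bij (fun a _ => K.1.erase a) (fun a _ => ?_) (fun a _ b _ hab => ?_)
    (fun F hF => ?_) (fun a _ => rfl)
  · rw [Finset.mem_powersetCard]
    exact ⟨Finset.erase_subset _ _, by rw [Finset.card_erase_of_mem a.2, T.card_cell K.1 K.2]; rfl⟩
  · exact Subtype.ext (Finset.erase_injOn K.1 a.2 b.2 hab)
  · obtain ⟨hFK, hcard⟩ := Finset.mem_powersetCard.mp hF
    obtain ⟨a, ha⟩ := exists_eq_erase hFK hcard (T.card_cell K.1 K.2)
    exact ⟨a, Finset.mem_univ a, ha.symm⟩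

/-- Elementwise divergence theorem: for a field with vanishing normal trace on the boundary, only
the jumps across the interfaces remain. -/
theorem volInt_divg (hd : 0 < d) (u : Fin d → BPoly T)
    (hu : ∀ F ∈ boundaryFacets T, ∀ K ∈ adj T F, ∀ x ∈ convexHull ℝ (F : Set (E d)),
      ∑ i, ev (u i) K x * outwardNormal K.1 F i = 0) :
    volInt T (ev (divg u)) = interfaceInt T (fun F => jumpVec T F (evVec u)) := by
  classical
  have hfl : ∀ F ∈ facets T, ∀ K : Cell T,
      ∑ i, outwardNormal K.1 F i * facetInt F (ev (u i) K) =
        facetInt F (fun x => ∑ i, ev (u i) K x * outwardNormal K.1 F i) := by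
    intro F hF K
    rw [facetInt, integral_finsetSum]
    · refine Finset.sum_congr rfl fun i _ => ?_
      rw [integral_mul_const, facetInt, mul_comm]
    · exact fun i _ => integrableOn_facet hd hF ((continuous_ev _ _).mul continuous_const)
  have hcell : ∀ K : Cell T, ∫ x in openCell T K, ev (divg u) K x =
      ∑ F ∈ K.1.powersetCard d, facetInt F (fun x => ∑ i, ev (u i) K x * outwardNormal K.1 F i) := by
    intro K
    simp_rw [ev_divg]
    rw [integral_finsetSum _ fun i _ => integrableOn_openCell_of_continuous K (continuous_ev _ _)]
    simp_rw [setIntegral_D hd]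
    rw [Finset.sum_comm]
    refine Finset.sum_congr rfl fun F hF => hfl F ?_ K
    obtain ⟨h1, h2⟩ := Finset.mem_powersetCard.mp hF
    exact mem_facets.mpr ⟨K, h1, h2⟩
  have hsum : volInt T (ev (divg u)) = ∑ F ∈ facets T, facetInt F (jumpVec T F (evVec u)) := by
    rw [volInt]
    simp_rw [hcell]
    -- Grouping the pairs of cell and facet by facet collects the one-sided normal traces into the
    -- jump.
    rw [Finset.sum_comm' (t' := facets T) (s' := fun F => adj T F)]
    · refine Finset.sum_congr rfl fun F hF => ?_
      unfold jumpVec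
      simp only [facetInt]
      rw [integral_finsetSum]
      · rfl
      · exact fun K _ => integrableOn_facet hd hF (continuous_finsetSum _ fun i _ =>
          (continuous_ev _ _).mul continuous_const)
    · intro K F
      simp only [Finset.mem_univ, true_and, Finset.mem_powersetCard, mem_adj, mem_facets]
      exact ⟨fun h => ⟨h.1, K, h⟩, fun h => ⟨h.1, h.2.choose_spec.2⟩⟩
  rw [hsum, interfaceInt]
  symm
  refine Finset.sum_subset (fun F hF => mem_facets_of_mem_interfaces hF) (fun F hF hFi => ?_)
  obtain ⟨m, rfl⟩ : ∃ m, d = m + 1 := ⟨d - 1, by omega⟩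
  -- The remaining facets lie in the boundary of `Ω`, where `hu` makes the normal trace zero.
  have hb := mem_boundaryFacets_of_notMem_interfaces hF hFi
  rw [facetInt]
  refine setIntegral_eq_zero_of_forall_eq_zero (fun x hx => ?_)
  exact Finset.sum_eq_zero fun K hK => hu F hb K hK x hx

/-- The product rule for jumps and averages on an interface. -/
theorem jumpVec_mul (hd : 0 < d) {F : Finset (E d)} (hF : F ∈ interfaces T) (p : BPoly T)
    (u : Fin d → BPoly T) (x : E d) :
    jumpVec T F (evVec fun i => p * u i) x =
      jump T F (ev p) x ⬝ᵥ avg T F (evVec u) x + jumpVec T F (evVec u) x * avg T F (ev p) x := by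
  classical
  obtain ⟨m, rfl⟩ : ∃ m, d = m + 1 := ⟨d - 1, by omega⟩
  have hcard := card_adj_of_mem_interfaces hF
  obtain ⟨-, -, hFd⟩ := mem_facets.mp (mem_facets_of_mem_interfaces hF)
  obtain ⟨K, L, hKL, hadj⟩ := Finset.card_eq_two.mp hcard
  -- With opposite normals and weights 1/2 the claim is `pq - p'q' = (p - p')(q + q')/2 + (q - q')(p
  -- + p')/2` in each component.
  have hn := outwardNormal_eq_neg hFd (K := K) (L := L) (by simp [hadj]) (by simp [hadj]) hKL
  simp only [jumpVec, jump, avg, evVec, dotProduct, hadj, Finset.card_pair hKL, Finset.sum_pair hKL, hn, ev_mul,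
    PiLp.neg_apply, Pi.smul_apply, Pi.add_apply, smul_eq_mul, Nat.cast_ofNat]
  rw [← Finset.sum_add_distrib, ← Finset.sum_add_distrib, Finset.sum_mul, ← Finset.sum_add_distrib]
  refine Finset.sum_congr rfl fun i _ => ?_
  ring

/-- Elementwise integration by parts. -/
theorem volInt_integration_by_parts (hd : 0 < d) (p : BPoly T) (u : Fin d → BPoly T)
    (hu : ∀ F ∈ boundaryFacets T, ∀ K ∈ adj T F, ∀ x ∈ convexHull ℝ (F : Set (E d)),
      ∑ i, ev (u i) K x * outwardNormal K.1 F i = 0) :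
    volInt T (fun K x => ∑ i, ev (D i p) K x * ev (u i) K x + ev p K x * ev (divg u) K x) =
      interfaceInt T (fun F x => jump T F (ev p) x ⬝ᵥ avg T F (evVec u) x) +
        interfaceInt T (fun F x => jumpVec T F (evVec u) x * avg T F (ev p) x) := by
  rw [← interfaceInt_add hd (fun F => continuous_jump_dotProduct_avg F p u)
    (fun F => continuous_jumpVec_mul_avg F u p)]
  simp_rw [← ev_divg_mul]
  have h := volInt_divg hd (fun i => p * u i) (fun F hF K hK x hx => by
    simp_rw [ev_mul, mul_assoc, ← Finset.mul_sum, hu F hF K hK x hx, mul_zero])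
  exact h.trans (interfaceInt_congr fun F hF x => jumpVec_mul hd hF p u x)

theorem avg_one {F : Finset (E d)} (hF : F ∈ interfaces T) (x : E d) :
    avg T F (ev (1 : BPoly T)) x = 1 := by
  simp [avg, card_adj_of_mem_interfaces hF]

end Interface

/-! ### The discrete spaces are linear -/

section Spaces
variable {d : ℕ} {Ω : Set (E d)} {T : Triangulation d Ω} {k : ℕ}

theorem one_mem_Vh : (1 : BPoly T) ∈ Vh T k := fun K => by simp

theorem add_mem_Vh {p q : BPoly T} (hp : p ∈ Vh T k) (hq : q ∈ Vh T k) : p + q ∈ Vh T k :=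
  fun K => (MvPolynomial.totalDegree_add _ _).trans (max_le (hp K) (hq K))

theorem sub_mem_Vh {p q : BPoly T} (hp : p ∈ Vh T k) (hq : q ∈ Vh T k) : p - q ∈ Vh T k :=
  fun K => (MvPolynomial.totalDegree_sub _ _).trans (max_le (hp K) (hq K))

theorem smul_mem_Vh (c : ℝ) {p : BPoly T} (hp : p ∈ Vh T k) : c • p ∈ Vh T k :=
  fun K => (MvPolynomial.totalDegree_smul_le _ _).trans (hp K)

theorem mid_mem {U₀ U₁ : State T} (h₀ : U₀ ∈ StateSpace T k) (h₁ : U₁ ∈ StateSpace T k) :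
    mid U₀ U₁ ∈ StateSpace T k := by
  obtain ⟨a1, a2, a3, a4, a5, a6⟩ := h₀
  obtain ⟨b1, b2, b3, b4, b5, b6⟩ := h₁
  have h {p q : BPoly T} (hp : p ∈ Vh T k) (hq : q ∈ Vh T k) : (1 / 2 : ℝ) • (p + q) ∈ Vh T k :=
    smul_mem_Vh _ (add_mem_Vh hp hq)
  refine ⟨h a1 b1, ⟨fun i => h (a2.1 i) (b2.1 i), fun F hF K hK x hx i => ?_⟩, h a3 b3, h a4 b4,
    h a5 b5, ⟨fun i => h (a6.1 i) (b6.1 i), fun F hF K hK x hx => ?_⟩⟩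
  · change ev ((1 / 2 : ℝ) • (U₀.vel i + U₁.vel i)) K x = 0
    rw [ev_smul, ev_add, a2.2 F hF K hK x hx i, b2.2 F hF K hK x hx i]; ring
  · change ∑ i, ev ((1 / 2 : ℝ) • (U₀.sig i + U₁.sig i)) K x * outwardNormal K.1 F i = 0
    have e : ∀ i, ev ((1 / 2 : ℝ) • (U₀.sig i + U₁.sig i)) K x * outwardNormal K.1 F i =
        (1 / 2) * (ev (U₀.sig i) K x * outwardNormal K.1 F i) +
          (1 / 2) * (ev (U₁.sig i) K x * outwardNormal K.1 F i) := fun i => by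
      rw [ev_smul, ev_add]; ring
    simp_rw [e, Finset.sum_add_distrib, ← Finset.mul_sum, a6.2 F hF K hK x hx,
      b6.2 F hF K hK x hx]
    ring

theorem normalTrace_mul_eq_zero {v : Fin d → BPoly T} (hv : v ∈ VhZero T k) (p : BPoly T) :
    ∀ F ∈ boundaryFacets T, ∀ K ∈ adj T F, ∀ x ∈ convexHull ℝ (F : Set (E d)),
      ∑ i, ev (p * v i) K x * outwardNormal K.1 F i = 0 :=
  fun F hF K hK x hx => Finset.sum_eq_zero fun i _ => by
    rw [ev_mul, hv.2 F hF K hK x hx i]; ring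

end Spaces

/-! ### Mass conservation -/

section Mass
variable {d : ℕ} {Ω : Set (E d)} {T : Triangulation d Ω} {k : ℕ}

/-- The constant 1 is an admissible test function; the integral of `div (ρv)` then cancels the jump
term. -/
theorem EqRho.volInt_eq (hd : 0 < d) {δ : ℝ} (hδ : 0 < δ) {U₀ U₁ : State T}
    (hmem : mid U₀ U₁ ∈ StateSpace T k) (h : EqRho T k δ U₀ U₁) :
    volInt T (ev U₁.rho) = volInt T (ev U₀.rho) := by
  have h1 := h 1 one_mem_Vh
  set U := mid U₀ U₁
  have hv := volInt_divg hd (fun i => U.rho * U.vel i) (normalTrace_mul_eq_zero hmem.2.1 U.rho)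
  have hI : interfaceInt T (fun F x => jumpVec T F (evVec fun i => U.rho * U.vel i) x *
      avg T F (ev (1 : BPoly T)) x) =
      interfaceInt T (fun F => jumpVec T F (evVec fun i => U.rho * U.vel i)) :=
    interfaceInt_congr fun F hF x => by rw [avg_one hF, mul_one]
  have hc := fun (p : BPoly T) K => integrableOn_openCell_of_continuous K (continuous_ev p K)
  have hV : volInt T (fun K x => ((ev U₁.rho K x - ev U₀.rho K x) / δ +
      ev (divg fun i => U.rho * U.vel i) K x) * ev (1 : BPoly T) K x) =
      δ⁻¹ * (volInt T (ev U₁.rho) - volInt T (ev U₀.rho)) +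
        volInt T (ev (divg fun i => U.rho * U.vel i)) := by
    rw [← volInt_sub (hc _) (hc _), ← volInt_const_mul, ← volInt_add _ (hc _)]
    · congr 1; funext K x; rw [ev_one]; ring
    · exact fun K => integrableOn_openCell_of_continuous K (by fun_prop)
  rw [hV, hI, hv] at h1
  have h2 : δ⁻¹ * (volInt T (ev U₁.rho) - volInt T (ev U₀.rho)) = 0 := by linarith
  have h3 := (mul_eq_zero.mp h2).resolve_left (inv_pos.mpr hδ).ne'
  linarith

/-- Orthogonality to constants: the projection preserves the total mass. -/
theorem IsProjScalar.volInt_eq (hΩ : interior (closure Ω) = Ω) {f : E d → ℝ}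
    (hf : MemLp f 2 (volume.restrict Ω)) {u : BPoly T} (h : IsProjScalar T k f u) :
    volInt T (ev u) = ∫ x in Ω, f x := by
  have h1 := h 1 one_mem_Vh
  simp only [ev_one, mul_one] at h1
  have : IsFiniteMeasure (volume.restrict Ω) := ⟨by
    rw [Measure.restrict_apply_univ]
    exact (measure_mono subset_closure).trans_lt (isCompact_closure_domain T).measure_lt_top⟩
  rw [← volInt_eq_setIntegral T hΩ f (hf.integrable one_le_two)]
  exact h1

end Mass

/-! ### Time grids -/

theorem grid_le {N : ℕ} {t : ℕ → ℝ} (ht : ∀ n < N, t n < t (n + 1)) {a b : ℕ} (hab : a ≤ b)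
    (hb : b ≤ N) : t a ≤ t b := by
  induction b, hab using Nat.le_induction with
  | base => exact le_rfl
  | succ b _ ih => exact (ih (by omega)).trans (ht b (by omega)).le

/-- The first alternative is needed for `N = 0`, where there is no grid interval. -/
theorem exists_mem_grid_interval {N : ℕ} {t : ℕ → ℝ} {s : ℝ} (hs : s ∈ Set.Icc (t 0) (t N)) :
    s = t 0 ∨ ∃ n < N, s ∈ Set.Icc (t n) (t (n + 1)) := by
  induction N with
  | zero => exact Or.inl (le_antisymm hs.2 hs.1)
  | succ N ih =>
    rcases le_total s (t N) with h | h
    · rcases ih ⟨hs.1, h⟩ with h0 | ⟨n, hn, hsn⟩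
      · exact Or.inl h0
      · exact Or.inr ⟨n, by omega, hsn⟩
    · exact Or.inr ⟨N, by omega, h, hs.2⟩

/-! ### Mass conservation at all times -/

section Scheme
variable {d : ℕ} {Ω : Set (E d)} {T : Triangulation d Ω} {k : ℕ} {P : Params}
  {Uinit : InitialData Ω} {N : ℕ} {t : ℕ → ℝ} {U : ℝ → State T}

theorem IsFullyDiscrete.grid_mem (ht0 : t 0 = 0) (ht : ∀ n < N, t n < t (n + 1))
    {n : ℕ} (hn : n ≤ N) : t n ∈ Set.Icc 0 (t N) :=
  ⟨ht0 ▸ grid_le ht (Nat.zero_le n) hn, grid_le ht hn le_rfl⟩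

theorem IsFullyDiscrete.mass_grid (hd : 0 < d) (hΩ : interior (closure Ω) = Ω) (ht0 : t 0 = 0)
    (ht : ∀ n < N, t n < t (n + 1)) (hU : IsFullyDiscrete T k P Uinit N t U) {n : ℕ} (hn : n ≤ N) :
    volInt T (ev (U (t n)).rho) = ∫ x in Ω, Uinit.rho x := by
  induction n with
  | zero => rw [ht0]; exact hU.init.2.1.volInt_eq hΩ Uinit.rho_mem
  | succ n ih =>
    rw [← ih (by omega)]
    exact (hU.eq_rho n (by omega)).volInt_eq hd (sub_pos.mpr (ht n (by omega)))
      (mid_mem (hU.mem _ (grid_mem ht0 ht (by omega))) (hU.mem _ (grid_mem ht0 ht hn)))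

/-- Between nodes the mass is an affine function of time with equal values at both ends. -/
theorem IsFullyDiscrete.mass_conservation (hd : 0 < d) (hΩ : interior (closure Ω) = Ω)
    (ht0 : t 0 = 0) (ht : ∀ n < N, t n < t (n + 1)) (hU : IsFullyDiscrete T k P Uinit N t U)
    {s : ℝ} (hs : s ∈ Set.Icc 0 (t N)) :
    volInt T (ev (U s).rho) = ∫ x in Ω, Uinit.rho x := by
  rw [← ht0] at hs
  rcases exists_mem_grid_interval hs with rfl | ⟨n, hn, hsn⟩
  · exact hU.mass_grid hd hΩ ht0 ht (Nat.zero_le N)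
  have h0 := hU.mass_grid hd hΩ ht0 ht hn.le
  have h1 := hU.mass_grid hd hΩ ht0 ht (n := n + 1) hn
  set c := (s - t n) / (t (n + 1) - t n)
  have hrho : (U s).rho = c • ((U (t (n + 1))).rho - (U (t n)).rho) + (U (t n)).rho := by
    rw [hU.interpolates n hn s hsn]; rfl
  have hc := fun (p : BPoly T) K => integrableOn_openCell_of_continuous K (continuous_ev p K)
  have e : ev (U s).rho = fun K x =>
      c * (ev (U (t (n + 1))).rho K x - ev (U (t n)).rho K x) + ev (U (t n)).rho K x := by
    funext K x; rw [hrho, ev_add, ev_smul, ev_sub]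
  rw [e, volInt_add (fun K => integrableOn_openCell_of_continuous K (by fun_prop)) (hc _),
    volInt_const_mul, volInt_sub (hc _) (hc _), h1, h0]
  ring

/-- The midpoint state is an actual value of `U`, so the integrability of `1/ρ` assumed at every
time applies to it. -/
theorem IsFullyDiscrete.mid_eq (ht : ∀ n < N, t n < t (n + 1))
    (hU : IsFullyDiscrete T k P Uinit N t U) {n : ℕ} (hn : n < N) :
    mid (U (t n)) (U (t (n + 1))) = U ((t n + t (n + 1)) / 2) := by
  have h := ht n hn
  rw [hU.interpolates n hn ((t n + t (n + 1)) / 2) ⟨by linarith, by linarith⟩,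
    show ((t n + t (n + 1)) / 2 - t n) / (t (n + 1) - t n) = 1 / 2 by
      have : t (n + 1) - t n ≠ 0 := by linarith
      field_simp; ring, mid]
  module

end Scheme

/-! ### The energy balance -/

section Energy

/-- The discrete derivatives of `ρ f̃` satisfy a discrete chain rule. -/
theorem Params.discrete_chain_rule (P : Params) (r₀ p₀ r₁ p₁ : ℝ) :
    P.dens r₁ p₁ - P.dens r₀ p₀ =
      (p₁ - p₀) * P.dqPhi r₀ p₀ r₁ p₁ + (r₁ - r₀) * P.dqRho r₀ p₀ r₁ p₁ := by
  -- The increment times the slope is the difference of values, even for equal arguments, so no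
  -- differentiability of `F` is needed. The sum of both terms averages the two coordinate paths
  -- from `(r₀, p₀)` to `(r₁, p₁)`.
  have h1 := sub_smul_dslope (fun p => P.dens r₁ p) p₀ p₁
  have h2 := sub_smul_dslope (fun p => P.dens r₀ p) p₀ p₁
  have h3 := sub_smul_dslope (fun r => P.dens r p₁) r₀ r₁
  have h4 := sub_smul_dslope (fun r => P.dens r p₀) r₀ r₁
  simp only [smul_eq_mul] at h1 h2 h3 h4
  rw [Params.dqPhi, Params.dqRho]
  linear_combination (-1 / 2) * (h1 + h2 + h3 + h4)

variable {d : ℕ} {Ω : Set (E d)} {T : Triangulation d Ω} {k : ℕ}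

/-- The convective terms of the momentum equation are skew-symmetric. -/
theorem convection_dot_self (ρ : BPoly T) (v : Fin d → BPoly T) (K : Cell T) (x : E d) :
    ∑ i, (ev (divg fun j => ρ * v i * v j) K x - ev (divg fun j => ρ * v j) K x * ev (v i) K x
      - 1 / 2 * ev ρ K x * ev (D i (∑ j, v j * v j)) K x) * ev (v i) K x = 0 := by
  have h : ∀ i, (ev (divg fun j => ρ * v i * v j) K x
      - ev (divg fun j => ρ * v j) K x * ev (v i) K x
      - 1 / 2 * ev ρ K x * ev (D i (∑ j, v j * v j)) K x) * ev (v i) K x =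
      ∑ j, ev ρ K x * ev (v j) K x * ev (D j (v i)) K x * ev (v i) K x -
        ∑ j, ev ρ K x * ev (v i) K x * ev (D i (v j)) K x * ev (v j) K x := by
    intro i
    simp only [ev_divg, D_sum, ev_sum, Finset.mul_sum, Finset.sum_mul, ← Finset.sum_sub_distrib]
    refine Finset.sum_congr rfl fun j _ => ?_
    simp only [D_mul, ev_add, ev_mul]
    ring
  -- After the product rule the two double sums differ only by exchanging `i` and `j`.
  simp_rw [h, Finset.sum_sub_distrib]
  rw [Finset.sum_comm, sub_self]

end Energy

section EnergyBalance
variable {d : ℕ} {Ω : Set (E d)} {T : Triangulation d Ω} {k : ℕ}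

theorem ev_mid_rho (U₀ U₁ : State T) (K : Cell T) (x : E d) :
    ev (mid U₀ U₁).rho K x = 1 / 2 * (ev U₀.rho K x + ev U₁.rho K x) := by
  rw [← ev_add, ← ev_smul]; rfl

theorem ev_mid_vel (U₀ U₁ : State T) (i : Fin d) (K : Cell T) (x : E d) :
    ev ((mid U₀ U₁).vel i) K x = 1 / 2 * (ev (U₀.vel i) K x + ev (U₁.vel i) K x) := by
  rw [← ev_add, ← ev_smul]; rfl

theorem ev_mid_sig (U₀ U₁ : State T) (i : Fin d) (K : Cell T) (x : E d) :
    ev ((mid U₀ U₁).sig i) K x = 1 / 2 * (ev (U₀.sig i) K x + ev (U₁.sig i) K x) := by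
  rw [← ev_add, ← ev_smul]; rfl

/-- The integrand of the momentum equation, tested with the velocity. -/
theorem momentum_dot_velocity (δ : ℝ) (U₀ U₁ : State T) (K : Cell T) (x : E d) :
    (∑ i, (ev (mid U₀ U₁).rho K x * ((ev (U₁.vel i) K x - ev (U₀.vel i) K x) / δ)
      + ev (divg (fun j => (mid U₀ U₁).rho * (mid U₀ U₁).vel i * (mid U₀ U₁).vel j)) K x
      - ev (divg (fun j => (mid U₀ U₁).rho * (mid U₀ U₁).vel j)) K x * ev ((mid U₀ U₁).vel i) K x
      - 1 / 2 * ev (mid U₀ U₁).rho K x *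
        ev (D i (∑ j, (mid U₀ U₁).vel j * (mid U₀ U₁).vel j)) K x
      + ev (mid U₀ U₁).rho K x * ev (D i (mid U₀ U₁).tau) K x
      - ev (mid U₀ U₁).mu K x * ev (D i (mid U₀ U₁).phi) K x) * ev ((mid U₀ U₁).vel i) K x) =
    ev (mid U₀ U₁).rho K x * (1 / 2 * (evVec U₁.vel K x ⬝ᵥ evVec U₁.vel K x -
        evVec U₀.vel K x ⬝ᵥ evVec U₀.vel K x)) * δ⁻¹
      + ev (mid U₀ U₁).rho K x * ∑ i, ev (D i (mid U₀ U₁).tau) K x * ev ((mid U₀ U₁).vel i) K x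
      - ev (mid U₀ U₁).mu K x *
        ∑ i, ev (D i (mid U₀ U₁).phi) K x * ev ((mid U₀ U₁).vel i) K x := by
  have hc := convection_dot_self (mid U₀ U₁).rho (mid U₀ U₁).vel K x
  have h1 : ev (mid U₀ U₁).rho K x * (1 / 2 * (evVec U₁.vel K x ⬝ᵥ evVec U₁.vel K x -
      evVec U₀.vel K x ⬝ᵥ evVec U₀.vel K x)) * δ⁻¹ =
      ∑ i, ev (mid U₀ U₁).rho K x * ((ev (U₁.vel i) K x - ev (U₀.vel i) K x) / δ) *
        ev ((mid U₀ U₁).vel i) K x := by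
    simp only [dotProduct, evVec, ← Finset.sum_sub_distrib, Finset.mul_sum, Finset.sum_mul]
    refine Finset.sum_congr rfl fun i _ => ?_
    rw [ev_mid_vel]; ring
  rw [h1, ← add_zero (∑ i, ev (mid U₀ U₁).rho K x * _ * _), ← hc, Finset.mul_sum, Finset.mul_sum,
    ← Finset.sum_add_distrib, ← Finset.sum_add_distrib, ← Finset.sum_sub_distrib]
  exact Finset.sum_congr rfl fun i _ => by ring

/-- The difference of two discrete gradient relations, tested with the midpoint value. -/
theorem gradient_relation_dot (U₀ U₁ : State T) (K : Cell T) (x : E d) :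
    (∑ i, (ev (U₁.sig i) K x - ev (D i U₁.phi) K x) * ev ((mid U₀ U₁).sig i) K x) -
      ∑ i, (ev (U₀.sig i) K x - ev (D i U₀.phi) K x) * ev ((mid U₀ U₁).sig i) K x =
    1 / 2 * (evVec U₁.sig K x ⬝ᵥ evVec U₁.sig K x - evVec U₀.sig K x ⬝ᵥ evVec U₀.sig K x) -
      ∑ i, ev (D i (U₁.phi - U₀.phi)) K x * ev ((mid U₀ U₁).sig i) K x := by
  simp only [dotProduct, evVec, ← Finset.sum_sub_distrib, Finset.mul_sum]
  refine Finset.sum_congr rfl fun i _ => ?_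
  rw [D_sub, ev_sub, ev_mid_sig]; ring

/-- One step of the scheme satisfies an exact discrete energy balance. -/
theorem energy_balance (hd : 0 < d) (P : Params) {δ : ℝ} (hδ : 0 < δ) {U₀ U₁ : State T}
    (hU₀ : U₀ ∈ StateSpace T k) (hU₁ : U₁ ∈ StateSpace T k)
    (hdens₀ : ∀ K, IntegrableOn (fun x => P.dens (ev U₀.rho K x) (ev U₀.phi K x)) (openCell T K))
    (hdens₁ : ∀ K, IntegrableOn (fun x => P.dens (ev U₁.rho K x) (ev U₁.phi K x)) (openCell T K))
    (hinv : ∀ K, IntegrableOn (fun x => (ev (mid U₀ U₁).rho K x)⁻¹) (openCell T K))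
    (hqphi : ∀ K, IntegrableOn (dqPhiField P U₀ U₁ K) (openCell T K))
    (hqrho : ∀ K, IntegrableOn (dqRhoField P U₀ U₁ K) (openCell T K))
    (eq_rho : EqRho T k δ U₀ U₁) (eq_vel : EqVel T k P δ U₀ U₁) (eq_phi : EqPhi T k P δ U₀ U₁)
    (eq_mu : EqMu T k P U₀ U₁) (eq_tau : EqTau T k P U₀ U₁)
    (eq_sig₀ : EqSig T k U₀) (eq_sig₁ : EqSig T k U₁) :
    energy T P U₁ = energy T P U₀
      - δ * volInt T (fun K x => P.eta * |ev (mid U₀ U₁).mu K x| ^ 2 / ev (mid U₀ U₁).rho K x)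
      - δ * Bh T P (mid U₀ U₁).phi (mid U₀ U₁).vel (mid U₀ U₁).vel := by
  obtain ⟨hrho, hvel, hphi, hmu, htau, hsig⟩ := mid_mem hU₀ hU₁
  have hdphi : U₁.phi - U₀.phi ∈ Vh T k := sub_mem_Vh hU₁.2.2.1 hU₀.2.2.1
  have hdrho : U₁.rho - U₀.rho ∈ Vh T k := sub_mem_Vh hU₁.1 hU₀.1
  -- The test functions are the variables conjugate to each equation; membership of the midpoint
  -- values and increments in the discrete spaces was just recorded.
  have e1 := eq_rho _ htau
  have e2 := eq_vel _ hvel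
  have e3 := eq_phi _ hmu
  have e4 := eq_mu _ hdphi
  have e5 := eq_tau _ hdrho
  have e6 := eq_sig₁ _ hsig
  have e7 := eq_sig₀ _ hsig
  simp_rw [momentum_dot_velocity] at e2
  have m1 := volInt_integration_by_parts hd (mid U₀ U₁).tau
    (fun i => (mid U₀ U₁).rho * (mid U₀ U₁).vel i) (normalTrace_mul_eq_zero hvel _)
  have m2 := volInt_integration_by_parts hd (U₁.phi - U₀.phi) (mid U₀ U₁).sig hsig.2
  have hc {g : Cell T → E d → ℝ} (hg : ∀ K, Continuous (g K)) :
      ∀ K, IntegrableOn (g K) (openCell T K) :=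
    fun K => integrableOn_openCell_of_continuous K (hg K)
  obtain ⟨R, hR⟩ : ∃ R : BPoly T,
    R = divg fun i => (mid U₀ U₁).rho * (mid U₀ U₁).vel i := ⟨_, rfl⟩
  rw [← hR] at e1 m1
  -- The integrands get opaque names, so that `hV` is a linear relation among atoms: `i1` to `i7`
  -- are the tested equations, `j1` and `j2` the integrations by parts, `n₀` and `n₁` the energy
  -- densities, `w` the dissipation.
  obtain ⟨i1, hi1⟩ : ∃ i : Cell T → E d → ℝ, i = fun K x =>
    ((ev U₁.rho K x - ev U₀.rho K x) / δ + ev R K x) * ev (mid U₀ U₁).tau K x := ⟨_, rfl⟩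
  obtain ⟨i2, hi2⟩ : ∃ i : Cell T → E d → ℝ, i = fun K x =>
    ev (mid U₀ U₁).rho K x * (1 / 2 * (evVec U₁.vel K x ⬝ᵥ evVec U₁.vel K x -
        evVec U₀.vel K x ⬝ᵥ evVec U₀.vel K x)) * δ⁻¹
      + ev (mid U₀ U₁).rho K x * ∑ i, ev (D i (mid U₀ U₁).tau) K x * ev ((mid U₀ U₁).vel i) K x
      - ev (mid U₀ U₁).mu K x *
        ∑ i, ev (D i (mid U₀ U₁).phi) K x * ev ((mid U₀ U₁).vel i) K x := ⟨_, rfl⟩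
  obtain ⟨i3, hi3⟩ : ∃ i : Cell T → E d → ℝ, i = fun K x =>
    ((ev U₁.phi K x - ev U₀.phi K x) / δ
      + ∑ i, ev (D i (mid U₀ U₁).phi) K x * ev ((mid U₀ U₁).vel i) K x
      + P.eta * (ev (mid U₀ U₁).mu K x / ev (mid U₀ U₁).rho K x)) *
        ev (mid U₀ U₁).mu K x := ⟨_, rfl⟩
  obtain ⟨i4, hi4⟩ : ∃ i : Cell T → E d → ℝ, i = fun K x =>
    (ev (mid U₀ U₁).mu K x - dqPhiField P U₀ U₁ K x + P.gamma * ev (divg (mid U₀ U₁).sig) K x) *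
      ev (U₁.phi - U₀.phi) K x := ⟨_, rfl⟩
  obtain ⟨i5, hi5⟩ : ∃ i : Cell T → E d → ℝ, i = fun K x =>
    (ev (mid U₀ U₁).tau K x - dqRhoField P U₀ U₁ K x
      - 1 / 4 * (evVec U₁.vel K x ⬝ᵥ evVec U₁.vel K x + evVec U₀.vel K x ⬝ᵥ evVec U₀.vel K x)) *
      ev (U₁.rho - U₀.rho) K x := ⟨_, rfl⟩
  obtain ⟨i6, hi6⟩ : ∃ i : Cell T → E d → ℝ, i = fun K x =>
    ∑ i, (ev (U₁.sig i) K x - ev (D i U₁.phi) K x) * ev ((mid U₀ U₁).sig i) K x := ⟨_, rfl⟩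
  obtain ⟨i7, hi7⟩ : ∃ i : Cell T → E d → ℝ, i = fun K x =>
    ∑ i, (ev (U₀.sig i) K x - ev (D i U₀.phi) K x) * ev ((mid U₀ U₁).sig i) K x := ⟨_, rfl⟩
  obtain ⟨j1, hj1⟩ : ∃ i : Cell T → E d → ℝ, i = fun K x =>
    ∑ i, ev (D i (mid U₀ U₁).tau) K x * ev ((mid U₀ U₁).rho * (mid U₀ U₁).vel i) K x +
      ev (mid U₀ U₁).tau K x * ev R K x := ⟨_, rfl⟩
  obtain ⟨j2, hj2⟩ : ∃ i : Cell T → E d → ℝ, i = fun K x =>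
    ∑ i, ev (D i (U₁.phi - U₀.phi)) K x * ev ((mid U₀ U₁).sig i) K x +
      ev (U₁.phi - U₀.phi) K x * ev (divg (mid U₀ U₁).sig) K x := ⟨_, rfl⟩
  obtain ⟨n₀, hn₀⟩ : ∃ n : Cell T → E d → ℝ, n = fun K x =>
    P.dens (ev U₀.rho K x) (ev U₀.phi K x)
      + P.gamma / 2 * (evVec U₀.sig K x ⬝ᵥ evVec U₀.sig K x)
      + ev U₀.rho K x / 2 * (evVec U₀.vel K x ⬝ᵥ evVec U₀.vel K x) := ⟨_, rfl⟩
  obtain ⟨n₁, hn₁⟩ : ∃ n : Cell T → E d → ℝ, n = fun K x =>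
    P.dens (ev U₁.rho K x) (ev U₁.phi K x)
      + P.gamma / 2 * (evVec U₁.sig K x ⬝ᵥ evVec U₁.sig K x)
      + ev U₁.rho K x / 2 * (evVec U₁.vel K x ⬝ᵥ evVec U₁.vel K x) := ⟨_, rfl⟩
  obtain ⟨w, hw⟩ : ∃ w : Cell T → E d → ℝ, w = fun K x =>
    P.eta * |ev (mid U₀ U₁).mu K x| ^ 2 / ev (mid U₀ U₁).rho K x := ⟨_, rfl⟩
  -- The whole balance before integration: subtracting `j1` removes the terms in `∇τ` and `τ div
  -- (ρv)`, and adding `γ j2` removes those in `∇(φ^{n+1} - φ^n)` and `div σ`.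
  have hpt : ∀ K x, n₁ K x - n₀ K x + δ * w K x =
      δ * (i1 K x + i2 K x + i3 K x - j1 K x) - i4 K x - i5 K x
        + P.gamma * (i6 K x - i7 K x + j2 K x) := by
    intro K x
    have h1 := P.discrete_chain_rule (ev U₀.rho K x) (ev U₀.phi K x) (ev U₁.rho K x)
      (ev U₁.phi K x)
    have h2 := gradient_relation_dot U₀ U₁ K x
    have h3 := ev_mid_rho U₀ U₁ K x
    have h4 : ∑ i, ev (D i (mid U₀ U₁).tau) K x * ev ((mid U₀ U₁).rho * (mid U₀ U₁).vel i) K x =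
        ev (mid U₀ U₁).rho K x *
          ∑ i, ev (D i (mid U₀ U₁).tau) K x * ev ((mid U₀ U₁).vel i) K x := by
      rw [Finset.mul_sum]
      exact Finset.sum_congr rfl fun i _ => by rw [ev_mul]; ring
    have h5 : δ * δ⁻¹ = 1 := mul_inv_cancel₀ hδ.ne'
    simp only [hi1, hi2, hi3, hi4, hi5, hi6, hi7, hj1, hj2, hn₀, hn₁, hw, dqPhiField, dqRhoField,
      sq_abs, ev_sub, div_eq_mul_inv] at h1 h2 h3 h4 ⊢
    rw [h2, h4]
    linear_combination h1 - ((ev U₁.rho K x - ev U₀.rho K x) * ev (mid U₀ U₁).tau K x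
      + ev (mid U₀ U₁).rho K x * (1 / 2 * (evVec U₁.vel K x ⬝ᵥ evVec U₁.vel K x -
        evVec U₀.vel K x ⬝ᵥ evVec U₀.vel K x))
      + (ev U₁.phi K x - ev U₀.phi K x) * ev (mid U₀ U₁).mu K x) * h5
      - (1 / 2 * (evVec U₁.vel K x ⬝ᵥ evVec U₁.vel K x -
        evVec U₀.vel K x ⬝ᵥ evVec U₀.vel K x)) * h3
  have k1 : ∀ K, IntegrableOn (i1 K) (openCell T K) := hc fun K => by rw [hi1]; fun_prop
  have k2 : ∀ K, IntegrableOn (i2 K) (openCell T K) := hc fun K => by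
    simp only [hi2, dotProduct, evVec]; fun_prop
  have kq : ∀ K (g : E d → ℝ), Continuous g →
      IntegrableOn (fun x => (ev (mid U₀ U₁).rho K x)⁻¹ * g x) (openCell T K) :=
    fun K g hg => integrableOn_openCell_mul_continuous (hinv K) hg
  have k3 : ∀ K, IntegrableOn (i3 K) (openCell T K) := fun K => by
    have h1 := kq K (fun x => P.eta * ev (mid U₀ U₁).mu K x * ev (mid U₀ U₁).mu K x) (by fun_prop)
    have h2 : IntegrableOn (fun x => ((ev U₁.phi K x - ev U₀.phi K x) / δ
      + ∑ i, ev (D i (mid U₀ U₁).phi) K x * ev ((mid U₀ U₁).vel i) K x) *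
        ev (mid U₀ U₁).mu K x) (openCell T K) :=
      integrableOn_openCell_of_continuous K (by fun_prop)
    refine (h2.add h1).congr_fun (fun x _ => ?_) isOpen_interior.measurableSet
    simp only [hi3, Pi.add_apply, div_eq_mul_inv]; ring
  have kw : ∀ K, IntegrableOn (w K) (openCell T K) := fun K => by
    refine (kq K (fun x => P.eta * |ev (mid U₀ U₁).mu K x| ^ 2) (by fun_prop)).congr_fun
      (fun x _ => ?_) isOpen_interior.measurableSet
    simp only [hw, div_eq_mul_inv]; ring
  have k4 : ∀ K, IntegrableOn (i4 K) (openCell T K) := fun K => by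
    rw [hi4]
    exact integrableOn_openCell_mul_continuous
      (((integrableOn_openCell_of_continuous K (continuous_ev _ K)).sub (hqphi K)).add
        (integrableOn_openCell_of_continuous K (continuous_const.mul (continuous_ev _ K))))
      (continuous_ev _ K)
  have k5 : ∀ K, IntegrableOn (i5 K) (openCell T K) := fun K => by
    rw [hi5]
    refine integrableOn_openCell_mul_continuous
      (((integrableOn_openCell_of_continuous K (continuous_ev _ K)).sub (hqrho K)).sub
        (integrableOn_openCell_of_continuous K ?_)) (continuous_ev _ K)
    simp only [dotProduct, evVec]; fun_prop
  have k6 : ∀ K, IntegrableOn (i6 K) (openCell T K) := hc fun K => by rw [hi6]; fun_prop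
  have k7 : ∀ K, IntegrableOn (i7 K) (openCell T K) := hc fun K => by rw [hi7]; fun_prop
  have kj1 : ∀ K, IntegrableOn (j1 K) (openCell T K) := hc fun K => by rw [hj1]; fun_prop
  have kj2 : ∀ K, IntegrableOn (j2 K) (openCell T K) := hc fun K => by rw [hj2]; fun_prop
  have kn (V : State T) (hV : ∀ K, IntegrableOn (fun x => P.dens (ev V.rho K x) (ev V.phi K x))
      (openCell T K)) (K : Cell T) : IntegrableOn (fun x => P.dens (ev V.rho K x) (ev V.phi K x)
      + P.gamma / 2 * (evVec V.sig K x ⬝ᵥ evVec V.sig K x)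
      + ev V.rho K x / 2 * (evVec V.vel K x ⬝ᵥ evVec V.vel K x)) (openCell T K) := by
    refine ((hV K).add (integrableOn_openCell_of_continuous K ?_)).add
      (integrableOn_openCell_of_continuous K ?_) <;>
    simp only [dotProduct, evVec] <;> fun_prop
  have kn₀ : ∀ K, IntegrableOn (n₀ K) (openCell T K) := hn₀ ▸ kn U₀ hdens₀
  have kn₁ : ∀ K, IntegrableOn (n₁ K) (openCell T K) := hn₁ ▸ kn U₁ hdens₁
  have hV : volInt T n₁ - volInt T n₀ + δ * volInt T w =
      δ * (volInt T i1 + volInt T i2 + volInt T i3 - volInt T j1) - volInt T i4 - volInt T i5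
        + P.gamma * (volInt T i6 - volInt T i7 + volInt T j2) := by
    have h1 := ((hasVolInt_volInt kn₁).sub (hasVolInt_volInt kn₀)).add
      ((hasVolInt_volInt kw).const_mul δ)
    have h2 := ((((((hasVolInt_volInt k1).add (hasVolInt_volInt k2)).add
      (hasVolInt_volInt k3)).sub (hasVolInt_volInt kj1)).const_mul δ).sub
      (hasVolInt_volInt k4)).sub (hasVolInt_volInt k5) |>.add
      ((((hasVolInt_volInt k6).sub (hasVolInt_volInt k7)).add
        (hasVolInt_volInt kj2)).const_mul P.gamma)
    rw [← h1.2, ← h2.2]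
    exact congrArg (volInt T) (funext fun K => funext fun x => hpt K x)
  have hs (p q : BPoly T) (u v : Fin d → BPoly T) := interfaceInt_sub (T := T) hd
    (fun F => continuous_jump_dotProduct_avg F p u) (fun F => continuous_jump_dotProduct_avg F q v)
  simp only [hs] at e2
  simp_rw [mul_assoc P.gamma (jumpVec _ _ _ _)] at e4
  simp only [interfaceInt_const_mul] at e4
  have hj : interfaceInt T (fun F x => jump T F (ev (U₁.phi - U₀.phi)) x ⬝ᵥ
      avg T F (evVec (mid U₀ U₁).sig) x) =
      interfaceInt T (fun F x => jump T F (ev U₁.phi) x ⬝ᵥ avg T F (evVec (mid U₀ U₁).sig) x) -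
      interfaceInt T (fun F x => jump T F (ev U₀.phi) x ⬝ᵥ avg T F (evVec (mid U₀ U₁).sig) x) := by
    rw [← hs]
    refine interfaceInt_congr fun F _ x => ?_
    rw [← sub_dotProduct]
    congr 1
    funext i
    simp only [jump, ev_sub, sub_mul, Finset.sum_sub_distrib, Pi.sub_apply]
  have f1 := (congrArg (volInt T) hi1).trans (sub_eq_zero.mp e1.symm)
  have f2 := (congrArg (volInt T) hi2).trans
    (sub_eq_iff_eq_add.mp (eq_neg_of_add_eq_zero_left e2.symm))
  have f3 := (congrArg (volInt T) hi3).trans (sub_eq_zero.mp e3.symm)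
  have f4 := (congrArg (volInt T) hi4).trans (sub_eq_zero.mp e4.symm)
  have f5 := (congrArg (volInt T) hi5).trans e5.symm
  have f6 := (congrArg (volInt T) hi6).trans (eq_neg_of_add_eq_zero_left e6.symm)
  have f7 := (congrArg (volInt T) hi7).trans (eq_neg_of_add_eq_zero_left e7.symm)
  have g1 := (congrArg (volInt T) hj1).trans m1
  have g2 := (congrArg (volInt T) hj2).trans m2
  -- Now every volume integral of a tested equation is an interface integral, plus `-Bh` for the
  -- momentum. The pairings of `τ` with `ρv`, of `φ` with `μv`, and of the increment of `φ` with `σ`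
  -- cancel.
  simp only [f1, f2, f3, f4, f5, f6, f7, g1, g2, hj] at hV
  have hE₁ : energy T P U₁ = volInt T n₁ := (congrArg (volInt T) hn₁).symm
  have hE₀ : energy T P U₀ = volInt T n₀ := (congrArg (volInt T) hn₀).symm
  rw [hE₁, hE₀, ← hw]
  linear_combination hV

end EnergyBalance

/-! ### The energy balance along the scheme -/

section Stability
variable {d : ℕ} {Ω : Set (E d)} {T : Triangulation d Ω} {k : ℕ} {P : Params}
  {Uinit : InitialData Ω} {N : ℕ} {t : ℕ → ℝ} {U : ℝ → State T}

theorem IsFullyDiscrete.energy_step (hd : 0 < d) (ht0 : t 0 = 0) (ht : ∀ n < N, t n < t (n + 1))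
    (hU : IsFullyDiscrete T k P Uinit N t U) {n : ℕ} (hn : n < N)
    (h0 : n = 0 → EqSig T k (U 0)) :
    energy T P (U (t (n + 1))) = energy T P (U (t n))
      - (t (n + 1) - t n) * volInt T (fun K x =>
          P.eta * |ev (mid (U (t n)) (U (t (n + 1)))).mu K x| ^ 2
            / ev (mid (U (t n)) (U (t (n + 1)))).rho K x)
      - (t (n + 1) - t n) * Bh T P (mid (U (t n)) (U (t (n + 1)))).phi
          (mid (U (t n)) (U (t (n + 1)))).vel (mid (U (t n)) (U (t (n + 1)))).vel := by
  have hlt := ht n hn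
  have m0 : t n ∈ Set.Icc 0 (t N) := grid_mem ht0 ht hn.le
  have m1 : t (n + 1) ∈ Set.Icc 0 (t N) := grid_mem ht0 ht hn
  have mm : (t n + t (n + 1)) / 2 ∈ Set.Icc 0 (t N) :=
    ⟨by linarith [m0.1], by linarith [m1.2]⟩
  -- The gradient relation at the old level comes from the previous step; for `n = 0` no such step
  -- exists, hence the condition on the initial data.
  have hsig : EqSig T k (U (t n)) := by
    rcases n with _ | n
    · rw [ht0]; exact h0 rfl
    · exact hU.eq_sig n (by omega)
  refine energy_balance hd P (sub_pos.mpr hlt) (hU.mem _ m0) (hU.mem _ m1)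
    (fun K => integrableOn_openCell_of_memLp ((hU.dens K).1 _ m0))
    (fun K => integrableOn_openCell_of_memLp ((hU.dens K).1 _ m1)) (fun K => ?_)
    (fun K => (hU.integrable n hn K).1) (fun K => (hU.integrable n hn K).2)
    (hU.eq_rho n hn) (hU.eq_vel n hn) (hU.eq_phi n hn) (hU.eq_mu n hn) (hU.eq_tau n hn) hsig
    (hU.eq_sig n hn)
  rw [hU.mid_eq ht hn]
  exact integrableOn_openCell_of_memLp ((hU.inv_rho K).1 _ mm)

end Stability

end NSAC

end

theorem mainTheorem4 {d : ℕ} (hd : 0 < d) {Ω : Set (NSAC.E d)}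
    (hΩ : interior (closure Ω) = Ω) (T : NSAC.Triangulation d Ω) (k : ℕ)
    (P : NSAC.Params) (Uinit : NSAC.InitialData Ω)
    (N : ℕ) (t : ℕ → ℝ) (ht0 : t 0 = 0) (ht : ∀ n < N, t n < t (n + 1))
    (U : ℝ → NSAC.State T) (hU : NSAC.IsFullyDiscrete T k P Uinit N t U) :
    (∀ s ∈ Set.Icc 0 (t N),
      NSAC.volInt T (fun K x => NSAC.ev (U s).rho K x) = ∫ x in Ω, Uinit.rho x) ∧
    (∀ n < N, (n = 0 → NSAC.EqSig T k (U 0)) →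
      NSAC.energy T P (U (t (n + 1))) ≤ NSAC.energy T P (U (t n))
        - (t (n + 1) - t n) * NSAC.volInt T (fun K x =>
            P.eta * |NSAC.ev (NSAC.mid (U (t n)) (U (t (n + 1)))).mu K x| ^ 2
              / NSAC.ev (NSAC.mid (U (t n)) (U (t (n + 1)))).rho K x)
        - (t (n + 1) - t n) * NSAC.Bh T P
            (NSAC.mid (U (t n)) (U (t (n + 1)))).phi
            (NSAC.mid (U (t n)) (U (t (n + 1)))).vel
            (NSAC.mid (U (t n)) (U (t (n + 1)))).vel) := by
  exact ⟨fun s hs => hU.mass_conservation hd hΩ ht0 ht hs,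
    fun n hn h0 => (hU.energy_step hd ht0 ht hn h0).le⟩
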